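/- **Setting.** Let $L$ be a finite set of locations, partitioned between the players $\mathsf{Min}$ and $\mathsf{Max}$, with goal locations $G\subseteq L_{\mathsf{Min}}$, let $\mathcal X$ be a set of two clocks, and let $T$ be a finite set of transitions $\ell\xrightarrow{C,X}\ell'$ with $\ell\notin G$, where the guard $C$ is a finite set of constraints $x\sim n$ ($x\in\mathcal X$, ${\sim}\in\{<,\le,=,\ge,>\}$, $n\in\mathbb N$) and $X\subseteq\mathcal X$ is the set of clocks that are reset. From a configuration $(\ell,\nu)$, $\nu\in\mathbb R_{\ge0}^{\mathcal X}$, the owner of $\ell$ chooses a delay $d\ge 0$ and a transition $\ell\xrightarrow{C,X}\ell'$ with $\nu+d\models C$, and the game moves to $(\ell',(\nu+d)[X:=0])$. A *region* is a class of valuations in $[0,1]^{\mathcal X}$ with the same clocks equal to $0$, the same clocks equal to $1$ and the same strict order between clocks. In a *two-clock kernel weighted timed game* all weights of locations and transitions are $0$, and: - every location $\ell$ is assigned a region $\mathsf{reg}(\ell)$ such that for each transition $\ell\xrightarrow{C,X}\ell'$ there is a region $r$ that contains every $\nu+d$ with $\nu\in\mathsf{reg}(\ell)$, $d\ge0$,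 $\nu+d\models C$, and $r[X:=0]=\mathsf{reg}(\ell')$; - no configuration $(\ell,\nu)$ with $\ell\notin G$, $\nu\in\mathsf{reg}(\ell)$ is deadlocked; - every $\ell\in G$ has an output function $w_{\mathsf{out}}(\ell,\cdot):\mathsf{reg}(\ell)\to\mathbb R$ that is continuous and piecewise linear (affine on each of finitely many polyhedra that cover $\mathsf{reg}(\ell)$). A play that reaches a goal configuration $(\ell,\nu)$ has weight $w_{\mathsf{out}}(\ell,\nu)$; an infinite play has weight $+\infty$. Strategies depend on the whole finite run so far. The upper value of a configuration is $\inf_{\sigma_{\mathsf{Min}}}\sup_{\sigma_{\mathsf{Max}}}$ of the weight of the resulting play, and the lower value is $\sup_{\sigma_{\mathsf{Max}}}\inf_{\sigma_{\mathsf{Min}}}$. When they agree, the common value at $(\ell,\nu)$ is written $W_\ell(\nu)$. The *value iteration functions* are $\mathrm{opt}^k_\ell=w_{\mathsf{out}}(\ell,\cdot)$ for $\ell\in G$ and all $k$; and, for $\ell\notin G$, $\mathrm{opt}^0_\ell=+\infty$ and $$\mathrm{opt}^{k+1}_\ell(\nu)=\inf\ (\text{resp. }\sup)\ \{\mathrm{opt}^{k}_{\ell'}((\nu+d)[X:=0])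 : \ell\xrightarrow{C,X}\ell'\in T,\ d\ge0,\ \nu+d\models C\}$$ if $\ell$ belongs to $\mathsf{Min}$ (resp. $\mathsf{Max}$). **Theorem.** In every two-clock kernel weighted timed game: 1. The upper and lower values agree at every configuration $(\ell,\nu)$ with $\nu\in\mathsf{reg}(\ell)$. For every location $\ell$, the function $W_\ell$ on $\mathsf{reg}(\ell)$ is either identically $+\infty$ or real-valued, continuous and piecewise linear. In particular, $W_\ell$ is continuous and piecewise linear whenever it is finite. 2. Value iteration terminates and computes the values: there is a $k$ such that $\mathrm{opt}^{k+1}_\ell=\mathrm{opt}^k_\ell=W_\ell$ on $\mathsf{reg}(\ell)$ for all locations $\ell$. Moreover, each function $\mathrm{opt}^k_\ell$ on $\mathsf{reg}(\ell)$ is either identically $+\infty$ or real-valued, continuous and piecewise linear, with coefficients (of the affine pieces and of the inequalities that define the polyhedra) in any subfield $K\subseteq\mathbb R$, for example $\mathbb Q$, over which all output functions are piecewise linear in this sense. -/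

import Mathlib

open scoped NNReal

namespace TimedGame

/-- The comparison symbols `<, ≤, =, ≥, >` of clock constraints. -/
inductive Cmp where
  | lt | le | eq | ge | gt

/-- `c.Holds a b` means `a c b`, for `c` one of `<, ≤, =, ≥, >`. -/
def Cmp.Holds : Cmp → ℝ≥0 → ℝ≥0 → Prop
  | .lt, a, b => a < b
  | .le, a, b => a ≤ b
  | .eq, a, b => a = b
  | .ge, a, b => a ≥ b
  | .gt, a, b => a > b

/-- A clock constraint `x ∼ n` with a natural number `n`. -/
structure Constraint (X : Type*) where
  clock : X
  cmp : Cmp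
  bound : ℕ

/-- Clock valuations. -/
abbrev Valuation (X : Type*) := X → ℝ≥0

/-- `ν + d`. -/
def Valuation.delay {X : Type*} (ν : Valuation X) (d : ℝ≥0) : Valuation X := fun x => ν x + d

open Classical in
/-- `ν[Y := 0]`. -/
noncomputable def Valuation.reset {X : Type*} (ν : Valuation X) (Y : Set X) : Valuation X :=
  fun x => if x ∈ Y then 0 else ν x

/-- `ν ⊨ C`. -/
def Valuation.Sat {X : Type*} (ν : Valuation X) (C : Finset (Constraint X)) : Prop :=
  ∀ c ∈ C, c.cmp.Holds (ν c.clock) c.bound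

/-- A discrete transition `source --(guard, resets)--> target`. -/
structure Transition (L X : Type*) where
  source : L
  guard : Finset (Constraint X)
  resets : Set X
  target : L

/-- The two players. -/
inductive Player where
  | min | max

/-- Turn-based weighted timed games with locations `L` and clocks `X`. -/
structure WTG (L X : Type*) where
  owner : L → Player
  goals : Set L
  goal_owner : ∀ l ∈ goals, owner l = Player.min
  trans : Finset (Transition L X)
  source_notMem_goals : ∀ t ∈ trans, t.source ∉ goals
  /-- Weight of a location per time unit (meaningful for non-goal locations). -/
  locWeight : L → ℤ
  /-- Weight of a transition (meaningful for members of `trans`). -/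
  transWeight : Transition L X → ℤ

/-- A configuration `(ℓ, ν)`. -/
structure Config (L X : Type*) where
  loc : L
  val : Valuation X

/-- A move `(d, t)`: wait `d` time units, then take `t`. -/
abbrev Move (L X : Type*) := ℝ≥0 × Transition L X

/-- The configuration that results from a move. -/
noncomputable def Config.next {L X : Type*} (c : Config L X) (m : Move L X) : Config L X :=
  ⟨m.2.target, (c.val.delay m.1).reset m.2.resets⟩

/-- A start configuration followed by a finite list of moves. -/
structure Run (L X : Type*) where
  start : Config L X
  moves : List (Move L X)

/-- The last configuration of a run. -/
noncomputable def Run.last {L X : Type*} (ρ : Run L X) : Config L X :=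
  ρ.moves.foldl Config.next ρ.start

/-- Append one move to a run. -/
def Run.snoc {L X : Type*} (ρ : Run L X) (m : Move L X) : Run L X :=
  ⟨ρ.start, ρ.moves ++ [m]⟩

namespace WTG

variable {L X : Type*}

/-- `(d, t)` is a valid delayed transition from the configuration `c`. -/
def Enabled (G : WTG L X) (c : Config L X) (m : Move L X) : Prop :=
  m.2 ∈ G.trans ∧ m.2.source = c.loc ∧ (c.val.delay m.1).Sat m.2.guard

/-- The moves in the list are successively valid, starting from `c`. -/
def ValidFrom (G : WTG L X) : Config L X → List (Move L X) → Prop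
  | _, [] => True
  | c, m :: ms => G.Enabled c m ∧ G.ValidFrom (c.next m) ms

/-- `ρ` is a finite run of `G`. -/
def IsRun (G : WTG L X) (ρ : Run L X) : Prop := G.ValidFrom ρ.start ρ.moves

/-- Some move is possible from `c`; a finite run is maximal iff this fails at its end. -/
def CanMove (G : WTG L X) (c : Config L X) : Prop := ∃ m, G.Enabled c m

/-- A strategy of player `P`: a valid move for every non-maximal finite run of `G` that ends in a
location of `P` (the values at other arguments are irrelevant). -/
def Strategy (G : WTG L X) (P : Player) : Type _ :=
  {σ : Run L X → Move L X //
    ∀ ρ, G.IsRun ρ → G.owner ρ.last.loc = P → G.CanMove ρ.last → G.Enabled ρ.last (σ ρ)}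

open Classical in
/-- The prefix with at most `n` moves of the play from `c` under the strategy profile `(σ, τ)`;
maximal finite runs are not extended. -/
noncomputable def play (G : WTG L X) (c : Config L X)
    (σ : G.Strategy Player.min) (τ : G.Strategy Player.max) : ℕ → Run L X
  | 0 => ⟨c, []⟩
  | n + 1 =>
    let ρ := G.play c σ τ n
    if G.CanMove ρ.last then
      match G.owner ρ.last.loc with
      | Player.min => ρ.snoc (σ.1 ρ)
      | Player.max => ρ.snoc (τ.1 ρ)
    else ρ

/-- Cumulative weight of a list of moves from `c`: the sum of the `d · w(ℓ) + w(t)`. -/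
noncomputable def movesWeight (G : WTG L X) : Config L X → List (Move L X) → ℝ
  | _, [] => 0
  | c, m :: ms =>
    ((m.1 : ℝ) * (G.locWeight c.loc : ℝ) + (G.transWeight m.2 : ℝ)) + G.movesWeight (c.next m) ms

end WTG

/-- A region of clock valuations in `[0,1]^X`: the set of all valuations in `[0,1]^X` with the same
clocks equal to `0`, the same clocks equal to `1`, and the same strict order between the clocks as
some fixed valuation. -/
def IsRegion {X : Type*} (r : Set (Valuation X)) : Prop :=
  ∃ ν : Valuation X, (∀ x, ν x ≤ 1) ∧
    r = {μ | (∀ x, μ x ≤ 1) ∧ (∀ x, μ x = 0 ↔ ν x = 0) ∧ (∀ x, μ x = 1 ↔ ν x = 1) ∧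
      ∀ x y, μ x < μ y ↔ ν x < ν y}

/-- An affine function `ν ↦ ∑ x, coeff x * ν x + const`. -/
structure AffineForm (X : Type*) where
  coeff : X → ℝ
  const : ℝ

/-- The value of an affine function at a valuation. -/
noncomputable def AffineForm.eval {X : Type*} [Fintype X] (a : AffineForm X) (ν : Valuation X) :
    ℝ :=
  ∑ x, a.coeff x * (ν x : ℝ) + a.const

/-- All coefficients of the affine function lie in `K`. -/
def AffineForm.Over {X : Type*} (a : AffineForm X) (K : Subfield ℝ) : Prop :=
  (∀ x, a.coeff x ∈ K) ∧ a.const ∈ K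

/-- `f` is piecewise linear on `D`, with coefficients in `K`: the set `D` is covered by finitely
many polyhedra, each given by finitely many affine inequalities `0 ≤ h`, and on each of them `f`
agrees on `D` with an affine function; all these affine functions have coefficients in `K`. -/
def PiecewiseLinearOver {X : Type*} [Fintype X] (K : Subfield ℝ)
    (f : Valuation X → ℝ) (D : Set (Valuation X)) : Prop :=
  ∃ (m : ℕ) (P : Fin m → Finset (AffineForm X)) (g : Fin m → AffineForm X),
    (∀ i, ∀ h ∈ P i, h.Over K) ∧ (∀ i, (g i).Over K) ∧
    (∀ ν ∈ D, ∃ i, ∀ h ∈ P i, 0 ≤ h.eval ν) ∧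
    (∀ i, ∀ ν ∈ D, (∀ h ∈ P i, 0 ≤ h.eval ν) → f ν = (g i).eval ν)

/-- `f` is piecewise linear on `D` (real coefficients). -/
def PiecewiseLinearOn {X : Type*} [Fintype X] (f : Valuation X → ℝ) (D : Set (Valuation X)) :
    Prop :=
  PiecewiseLinearOver ⊤ f D

/-- Kernel weighted timed games: every location is assigned a region of valuations in `[0,1]^X`
that the transitions respect, all weights are zero, and every goal location carries a continuous
piecewise-linear output function on its region. -/
structure KernelWTG (L X : Type*) [Fintype X] extends WTG L X where
  locWeight_zero : ∀ l, l ∉ goals → locWeight l = 0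
  transWeight_zero : ∀ t ∈ trans, transWeight t = 0
  /-- The region assignment. -/
  reg : L → Set (Valuation X)
  reg_isRegion : ∀ l, IsRegion (reg l)
  /-- For every transition, the valuations that satisfy its guard after a delay from the region of
  its source lie in one region `r`, and `r[resets := 0]` is the region of its target. -/
  reg_trans : ∀ t ∈ trans, ∃ r, IsRegion r ∧
    (∀ ν ∈ reg t.source, ∀ d, (ν.delay d).Sat t.guard → ν.delay d ∈ r) ∧
    (fun ν => ν.reset t.resets) '' r = reg t.target
  /-- No configuration of the game at a non-goal location is deadlocked. -/
  deadlock_free : ∀ l, l ∉ goals → ∀ ν ∈ reg l, toWTG.CanMove ⟨l, ν⟩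
  /-- The output functions (meaningful for a goal location, on its region). -/
  out : L → Valuation X → ℝ
  out_continuousOn : ∀ l ∈ goals, ContinuousOn (out l) (reg l)
  out_piecewiseLinearOn : ∀ l ∈ goals, PiecewiseLinearOn (out l) (reg l)

namespace KernelWTG

variable {L X : Type*} [Fintype X]

open Classical in
/-- Weight of the play from `c` under `(σ, τ)`: the weight of the run plus the output weight at the
goal configuration if a goal location is reached, and `+∞` otherwise. -/
noncomputable def payoff (G : KernelWTG L X) (c : Config L X)
    (σ : G.Strategy Player.min) (τ : G.Strategy Player.max) : EReal :=
  if h : ∃ n, (G.play c σ τ n).last.loc ∈ G.goals then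
    let ρ := G.play c σ τ (Nat.find h)
    ((G.movesWeight ρ.start ρ.moves + G.out ρ.last.loc ρ.last.val : ℝ) : EReal)
  else ⊤

/-- The upper value `inf_σ sup_τ`. -/
noncomputable def upperValue (G : KernelWTG L X) (c : Config L X) : EReal :=
  ⨅ σ : G.Strategy Player.min, ⨆ τ : G.Strategy Player.max, G.payoff c σ τ

/-- The lower value `sup_τ inf_σ`. -/
noncomputable def lowerValue (G : KernelWTG L X) (c : Config L X) : EReal :=
  ⨆ τ : G.Strategy Player.max, ⨅ σ : G.Strategy Player.min, G.payoff c σ τ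

open Classical in
/-- The value iteration functions: `G.opt k ℓ ν` is the `k`-th function of location `ℓ` at `ν`. -/
noncomputable def opt (G : KernelWTG L X) : ℕ → L → Valuation X → EReal
  | 0, l, ν => if l ∈ G.goals then (G.out l ν : EReal) else ⊤
  | k + 1, l, ν =>
    if l ∈ G.goals then (G.out l ν : EReal)
    else match G.owner l with
      | Player.min => ⨅ (m : Move L X) (_ : G.Enabled ⟨l, ν⟩ m),
          G.opt k m.2.target ((ν.delay m.1).reset m.2.resets)
      | Player.max => ⨆ (m : Move L X) (_ : G.Enabled ⟨l, ν⟩ m),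
          G.opt k m.2.target ((ν.delay m.1).reset m.2.resets)

end KernelWTG

end TimedGame

/-!
Why value iteration terminates in a two-clock kernel game.

Call a function a *continuous selection* of a finite family of affine functions if it is continuous
and agrees at every point with a member of the family. On a convex set, a continuous selection is
given by one member on each of the finitely many polyhedra on which the family is totally ordered
(`exists_form_on_cells`). Hence it is piecewise linear over any field that contains the
coefficients, and there are only finitely many continuous selections of a given family. As the value
iteration functions decrease, they become stationary as soon as they are all continuous selections
of one finite family. Finding that family is the heart of the matter.

On a region, either some clock `x` is integral, and a function of the valuation is a function `f y`
of the other clock, or the region is open: `0 < x ≤ y < 1` for one of the two orders of the clocks.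
If a transition leads into a region with an integral clock, the delay is forced, and the target
function is evaluated at a clock value `0`, `1`, `z` or `1 - z`, or at a function of the difference
of the clocks. If it leads into an open region, the player optimizes over the diagonal ray above the
current valuation (`futureInf`). The optimal value is then that of an affine piece at the current
point, at the end of the ray, or at a crossing of two pieces (`isSelection_futureInf`). For a
function of one clock the crossings only produce constants, and these produce no new ones
(`exists_closedFamily`).

Crossings between the functions of one clock and the outputs on the open regions would produce new
slopes again and again, but they never occur, because the players may wait in the open region. A
value of the minimizing player is nondecreasing in time (`Rising`), so waiting gives no further
improvement to that player, while the other one waits until the end of the ray, where the value is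
a function of the difference of the clocks only. Minima of rising functions are rising
(`Rising.min`), and so the description of the value iteration functions is preserved
(`KernelWTG.isTopOrRepresented_opt`). The maximizing player is treated by negation, under which all
families are closed.

Finally, the minimizing player can realize any bound above `opt k` within `k` rounds, and at a
fixed point of the iteration the maximizing player can defend any bound below it
(`KernelWTG.values_eq_opt`).
-/

namespace TimedGame

open Set Filter Topology

/-! ### Continuous selections of finite families -/

/-- Near a point `t`, a continuous selection of a finite family only uses members of the family
that agree with it at `t`. -/
lemma eventually_selection {α : Type*} [TopologicalSpace α] {Θ : Set (α → ℝ)} (hΘ : Θ.Finite)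
    {u : α → ℝ} {s : Set α} {t : α} (hu : ContinuousWithinAt u s t)
    (hc : ∀ θ ∈ Θ, ContinuousWithinAt θ s t) (hsel : ∀ r ∈ s, ∃ θ ∈ Θ, u r = θ r) :
    ∀ᶠ r in 𝓝[s] t, ∃ θ ∈ Θ, θ t = u t ∧ u r = θ r := by
  have h : ∀ᶠ r in 𝓝[s] t, ∀ θ ∈ Θ, θ t ≠ u t → u r ≠ θ r := by
    rw [eventually_all_finite hΘ]
    intro θ hθ
    by_cases hne : θ t = u t
    · exact Eventually.of_forall fun r h => absurd hne h
    · have h1 : ContinuousWithinAt (fun r => u r - θ r) s t := hu.sub (hc θ hθ)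
      have h2 : u t - θ t ≠ 0 := fun h => hne (by linarith)
      filter_upwards [h1.eventually_ne h2] with r hr _ h
      exact hr (by linarith)
  filter_upwards [h, self_mem_nhdsWithin] with r hr hrs
  obtain ⟨θ, hθ, h⟩ := hsel r hrs
  exact ⟨θ, hθ, by_contra fun hne => hr θ hθ hne h, h⟩

/-- A continuous selection of finitely many `K`-Lipschitz functions on a convex set is
`K`-Lipschitz: along a segment it can change from one function to another only where they agree. -/
lemma lipschitzOnWith_of_selection {E : Type*} [NormedAddCommGroup E] [NormedSpace ℝ E]
    {D : Set E} (hD : Convex ℝ D) {Θ : Set (E → ℝ)} (hΘ : Θ.Finite) {K : ℝ≥0}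
    (hK : ∀ θ ∈ Θ, LipschitzWith K θ) {f : E → ℝ} (hf : ContinuousOn f D)
    (hsel : ∀ p ∈ D, ∃ θ ∈ Θ, f p = θ p) : LipschitzOnWith K f D := by
  refine LipschitzOnWith.of_dist_le_mul fun a ha b hb => ?_
  set γ : ℝ → E := fun t => a + t • (b - a) with hγ
  have hγc : Continuous γ := by fun_prop
  have hγD : ∀ t ∈ Icc (0 : ℝ) 1, γ t ∈ D := fun t ht => hD.add_smul_sub_mem ha hb ht
  have hγd : ∀ s t, dist (γ s) (γ t) = |s - t| * dist a b := by
    intro s t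
    rw [dist_eq_norm, dist_comm a b, dist_eq_norm, hγ]
    have : a + s • (b - a) - (a + t • (b - a)) = (s - t) • (b - a) := by module
    simp only [this, norm_smul, Real.norm_eq_abs]
  have hfc : ContinuousOn (fun t => f (γ t)) (Icc 0 1) :=
    hf.comp hγc.continuousOn hγD
  -- the times up to which the bound holds form a closed set that is open to the right
  set S : Set ℝ := {t | dist (f (γ 0)) (f (γ t)) ≤ K * (t * dist a b)} with hS
  have hclosed : IsClosed (S ∩ Icc 0 1) := by
    have h1 : ContinuousOn (fun t => dist (f (γ 0)) (f (γ t)) - K * (t * dist a b)) (Icc 0 1) := by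
      simp only [Real.dist_eq]
      exact (continuousOn_const.sub hfc).abs.sub (by fun_prop)
    have h := h1.preimage_isClosed_of_isClosed isClosed_Icc (isClosed_Iic (a := (0 : ℝ)))
    convert h using 1
    ext t
    simp [hS, and_comm]
  have hmem : (1 : ℝ) ∈ S := by
    refine hclosed.mem_of_ge_of_forall_exists_gt ?_ zero_le_one ?_
    · simp [hS]
    · rintro t ⟨htS, ht⟩
      have hev := eventually_selection (Θ := (fun θ t => θ (γ t)) '' Θ) (hΘ.image _)
        (u := fun t => f (γ t)) (s := Icc 0 1) (t := t)
        (hfc t (Ico_subset_Icc_self ht))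
        (by
          rintro _ ⟨θ, hθ, rfl⟩
          exact ((hK θ hθ).continuous.comp hγc).continuousWithinAt)
        (by
          intro r hr
          obtain ⟨θ, hθ, h⟩ := hsel _ (hγD r hr)
          exact ⟨_, ⟨θ, hθ, rfl⟩, h⟩)
      have hev' : ∀ᶠ r in 𝓝[>] t, r ∈ Ioc t 1 ∧
          ∃ θ ∈ (fun θ t => θ (γ t)) '' Θ, θ t = f (γ t) ∧ f (γ r) = θ r := by
        refine Eventually.and (Ioc_mem_nhdsGT ht.2) ?_
        have : 𝓝[>] t ≤ 𝓝[Icc 0 1] t := by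
          rw [← nhdsWithin_Ioc_eq_nhdsGT ht.2]
          exact nhdsWithin_mono _ fun r hr => ⟨ht.1.trans hr.1.le, hr.2⟩
        exact this hev
      obtain ⟨r, hr, _, ⟨θ, hθ, rfl⟩, h1, h2⟩ := hev'.exists
      refine ⟨r, ?_, hr⟩
      have h3 := (hK θ hθ).dist_le_mul (γ t) (γ r)
      rw [hγd, abs_sub_comm, abs_of_pos (sub_pos.2 hr.1)] at h3
      have h1' : θ (γ t) = f (γ t) := h1
      rw [h1'] at h3
      have h2' : f (γ r) = θ (γ r) := h2
      rw [← h2'] at h3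
      have h4 := dist_triangle (f (γ 0)) (f (γ t)) (f (γ r))
      have h5 : dist (f (γ 0)) (f (γ t)) ≤ K * (t * dist a b) := htS
      change dist (f (γ 0)) (f (γ r)) ≤ K * (r * dist a b)
      linarith [show (K : ℝ) * (r * dist a b) =
        K * (t * dist a b) + K * ((r - t) * dist a b) by ring]
  have h : dist (f (γ 0)) (f (γ 1)) ≤ K * (1 * dist a b) := hmem
  simpa [hγ] using h

/-- A continuous selection of finitely many Lipschitz functions on a convex set extends to a
continuous function that is a selection on the closure. -/
lemma exists_continuous_extension_of_selection {E : Type*} [NormedAddCommGroup E]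
    [NormedSpace ℝ E] {D : Set E} (hD : Convex ℝ D) {Θ : Set (E → ℝ)} (hΘ : Θ.Finite)
    (hK : ∀ θ ∈ Θ, ∃ K : ℝ≥0, LipschitzWith K θ) {f : E → ℝ} (hf : ContinuousOn f D)
    (hsel : ∀ p ∈ D, ∃ θ ∈ Θ, f p = θ p) :
    ∃ g : E → ℝ, Continuous g ∧ EqOn f g D ∧ ∀ p ∈ closure D, ∃ θ ∈ Θ, g p = θ p := by
  choose! K hK using hK
  obtain ⟨K', hK'⟩ := (hΘ.image K).bddAbove
  have hlip : ∀ θ ∈ Θ, LipschitzWith K' θ := fun θ hθ =>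
    (hK θ hθ).weaken (hK' ⟨θ, hθ, rfl⟩)
  obtain ⟨g, hg, hfg⟩ := (lipschitzOnWith_of_selection hD hΘ hlip hf hsel).extend_real
  refine ⟨g, hg.continuous, hfg, ?_⟩
  have hcl : IsClosed (⋃ θ ∈ Θ, {p | g p = θ p}) :=
    hΘ.isClosed_biUnion fun θ hθ => isClosed_eq hg.continuous (hlip θ hθ).continuous
  have hsub : closure D ⊆ ⋃ θ ∈ Θ, {p | g p = θ p} := by
    refine closure_minimal (fun p hp => ?_) hcl
    obtain ⟨θ, hθ, h⟩ := hsel p hp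
    exact mem_biUnion hθ (show g p = θ p by rw [← h, hfg hp])
  intro p hp
  simpa using hsub hp

/-- At an interior local minimum of a continuous selection of finitely many affine functions
of one variable, either an affine function with slope zero is used or two affine functions with
different slopes cross. -/
lemma exists_crossing_of_isLocalMin {Θ : Set (ℝ × ℝ)} (hΘ : Θ.Finite) {u : ℝ → ℝ} {t : ℝ}
    (hu : ContinuousOn u (Icc 0 1)) (hsel : ∀ r ∈ Icc (0 : ℝ) 1, ∃ θ ∈ Θ, u r = θ.1 * r + θ.2)
    (ht : t ∈ Ioo (0 : ℝ) 1) (hmin : ∀ r ∈ Icc (0 : ℝ) 1, u t ≤ u r) :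
    (∃ θ ∈ Θ, θ.1 = 0 ∧ θ.2 = u t) ∨
      ∃ θ ∈ Θ, ∃ θ' ∈ Θ, θ.1 ≠ θ'.1 ∧ θ.1 * t + θ.2 = u t ∧ θ'.1 * t + θ'.2 = u t := by
  have hev := eventually_selection (Θ := (fun θ : ℝ × ℝ => fun r => θ.1 * r + θ.2) '' Θ)
    (hΘ.image _) (hu t (Ioo_subset_Icc_self ht))
    (by
      rintro _ ⟨θ, hθ, rfl⟩
      exact (by fun_prop : Continuous fun r => θ.1 * r + θ.2).continuousWithinAt)
    (by
      intro r hr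
      obtain ⟨θ, hθ, h⟩ := hsel r hr
      exact ⟨_, ⟨θ, hθ, rfl⟩, h⟩)
  rw [nhdsWithin_eq_nhds.2 (Icc_mem_nhds ht.1 ht.2)] at hev
  have hR := Eventually.and (Ioo_mem_nhdsGT ht.2)
    (hev.filter_mono (nhdsWithin_le_nhds (s := Ioi t)))
  have hL := Eventually.and (Ioo_mem_nhdsLT ht.1)
    (hev.filter_mono (nhdsWithin_le_nhds (s := Iio t)))
  obtain ⟨r, hr, _, ⟨θ, hθ, rfl⟩, h1, h2⟩ := hR.exists
  obtain ⟨s, hs, _, ⟨θ', hθ', rfl⟩, h1', h2'⟩ := hL.exists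
  simp only at h1 h2 h1' h2'
  by_cases h0 : θ.1 = 0
  · left
    exact ⟨θ, hθ, h0, by rw [← h1, h0]; ring⟩
  · right
    refine ⟨θ, hθ, θ', hθ', fun heq => h0 ?_, h1, h1'⟩
    have h3 := hmin r ⟨ht.1.le.trans hr.1.le, hr.2.le⟩
    have h4 := hmin s ⟨hs.1.le, hs.2.le.trans ht.2.le⟩
    rw [← heq] at h1' h2'
    have h5 : 0 ≤ θ.1 * (r - t) := by linarith
    have h6 : 0 ≤ θ.1 * (s - t) := by linarith
    have h7 : 0 ≤ θ.1 := nonneg_of_mul_nonneg_left h5 (sub_pos.2 hr.1)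
    have h8 : θ.1 ≤ 0 := by
      by_contra hpos
      push Not at hpos
      have := mul_neg_of_pos_of_neg hpos (sub_neg.2 hs.2)
      linarith
    exact le_antisymm h8 h7

/-! ### Piecewise linearity of continuous selections -/

section Cells

variable {X : Type*} [Fintype X]

lemma AffineForm.eval_combo (θ : AffineForm X) (μ ν : Valuation X) {a b : ℝ≥0} (hab : a + b = 1) :
    θ.eval (a • μ + b • ν) = a * θ.eval μ + b * θ.eval ν := by
  have h : (a : ℝ) + b = 1 := by exact_mod_cast hab
  have h1 : θ.const = a * θ.const + b * θ.const := by rw [← add_mul, h, one_mul]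
  simp only [AffineForm.eval, Pi.add_apply, Pi.smul_apply, smul_eq_mul, NNReal.coe_add,
    NNReal.coe_mul, mul_add, Finset.mul_sum, Finset.sum_add_distrib]
  rw [h1]
  have h2 : ∀ (c : ℝ) (κ : Valuation X),
      ∑ x, θ.coeff x * (c * (κ x : ℝ)) = ∑ x, c * (θ.coeff x * (κ x : ℝ)) :=
    fun c κ => Finset.sum_congr rfl fun x _ => by ring
  rw [h2, h2, ← h1]
  linarith

lemma AffineForm.continuous_eval (θ : AffineForm X) : Continuous θ.eval := by
  unfold AffineForm.eval
  fun_prop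

/-- A point at which two of the forms agree only if they agree on all of `C`. -/
lemma exists_generic_point {ι : Type*} (θ : ι → AffineForm X) {C : Set (Valuation X)}
    (hC : Convex ℝ≥0 C) (hne : C.Nonempty)
    (hcmp : ∀ i j, (∀ ν ∈ C, (θ i).eval ν ≤ (θ j).eval ν) ∨
      ∀ ν ∈ C, (θ j).eval ν ≤ (θ i).eval ν) (S : Finset (ι × ι)) :
    ∃ p ∈ C, ∀ k ∈ S, (∃ q ∈ C, (θ k.1).eval q ≠ (θ k.2).eval q) →
      (θ k.1).eval p ≠ (θ k.2).eval p := by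
  classical
  induction S using Finset.induction_on with
  | empty =>
    obtain ⟨p, hp⟩ := hne
    exact ⟨p, hp, by simp⟩
  | insert k S _ ih =>
    obtain ⟨p, hp, h⟩ := ih
    by_cases hk : ∃ q ∈ C, (θ k.1).eval q ≠ (θ k.2).eval q
    · obtain ⟨q, hq, hkq⟩ := hk
      have hab : (2⁻¹ : ℝ≥0) + 2⁻¹ = 1 := by
        rw [← NNReal.coe_inj]; push_cast; norm_num
      -- all differences have a constant sign on `C`, so nothing cancels at the midpoint
      have key : ∀ i j, ((θ i).eval p ≠ (θ j).eval p ∨ (θ i).eval q ≠ (θ j).eval q) →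
          (θ i).eval ((2⁻¹ : ℝ≥0) • p + (2⁻¹ : ℝ≥0) • q) ≠
            (θ j).eval ((2⁻¹ : ℝ≥0) • p + (2⁻¹ : ℝ≥0) • q) := by
        intro i j hij heq
        rw [AffineForm.eval_combo _ _ _ hab, AffineForm.eval_combo _ _ _ hab] at heq
        push_cast at heq
        rcases hcmp i j with h' | h' <;> have h1 := h' p hp <;> have h2 := h' q hq <;>
          rcases hij with h3 | h3 <;> apply h3 <;> linarith
      refine ⟨_, hC hp hq zero_le zero_le hab, fun k' hk' hex => ?_⟩
      rcases Finset.mem_insert.1 hk' with rfl | hk'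
      · exact key _ _ (Or.inr hkq)
      · exact key _ _ (Or.inl (h k' hk' hex))
    · refine ⟨p, hp, fun k' hk' hex => ?_⟩
      rcases Finset.mem_insert.1 hk' with rfl | hk'
      · exact absurd hex hk
      · exact h k' hk' hex

/-- On a convex set on which finitely many affine forms are totally ordered, a continuous
selection of the forms agrees with one of them: it does so at a generic point, and on the segments
that leave a generic point it cannot jump to another form. -/
lemma exists_form_of_selection {ι : Type*} [Finite ι] (θ : ι → AffineForm X)
    {C : Set (Valuation X)} (hC : Convex ℝ≥0 C) (hne : C.Nonempty)
    (hcmp : ∀ i j, (∀ ν ∈ C, (θ i).eval ν ≤ (θ j).eval ν) ∨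
      ∀ ν ∈ C, (θ j).eval ν ≤ (θ i).eval ν)
    {f : Valuation X → ℝ} (hf : ContinuousOn f C) (hsel : ∀ ν ∈ C, ∃ i, f ν = (θ i).eval ν) :
    ∃ i, ∀ ν ∈ C, f ν = (θ i).eval ν := by
  have := Fintype.ofFinite ι
  obtain ⟨p, hp, hgen⟩ := exists_generic_point θ hC hne hcmp Finset.univ
  obtain ⟨i, hi⟩ := hsel p hp
  refine ⟨i, fun b hb => by_contra fun hbne => ?_⟩
  set γ : ℝ → Valuation X := fun t => (1 - t).toNNReal • p + t.toNNReal • b with hγ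
  have hsum : ∀ t ∈ Icc (0 : ℝ) 1, (1 - t).toNNReal + t.toNNReal = 1 := by
    intro t ht
    rw [← Real.toNNReal_add (sub_nonneg.2 ht.2) ht.1]
    simp
  have hγC : ∀ t ∈ Icc (0 : ℝ) 1, γ t ∈ C := fun t ht =>
    hC hp hb zero_le zero_le (hsum t ht)
  have hγe : ∀ t ∈ Icc (0 : ℝ) 1, ∀ j,
      (θ j).eval (γ t) = (1 - t) * (θ j).eval p + t * (θ j).eval b := by
    intro t ht j
    rw [hγ, AffineForm.eval_combo _ _ _ (hsum t ht), Real.coe_toNNReal _ (sub_nonneg.2 ht.2),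
      Real.coe_toNNReal _ ht.1]
  have hγc : Continuous γ := by
    have := continuous_real_toNNReal
    fun_prop
  -- a lower bound for the nonzero gaps at the generic point; gaps shrink at most linearly along `γ`
  obtain ⟨ε, hε, hεj⟩ : ∃ ε > (0 : ℝ), ∀ j, (θ j).eval p ≠ (θ i).eval p →
      ε ≤ |(θ j).eval p - (θ i).eval p| := by
    have h : ∀ᶠ ε in 𝓝[>] (0 : ℝ), ∀ j, (θ j).eval p ≠ (θ i).eval p →
        ε ≤ |(θ j).eval p - (θ i).eval p| := by
      rw [eventually_all]
      intro j
      by_cases h : (θ j).eval p = (θ i).eval p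
      · exact Eventually.of_forall fun _ h' => absurd h h'
      · filter_upwards [Ioo_mem_nhdsGT (abs_pos.2 (sub_ne_zero.2 h))] with ε hε _
        exact hε.2.le
    obtain ⟨ε, h1, h2⟩ := (h.and self_mem_nhdsWithin).exists
    exact ⟨ε, h2, h1⟩
  set w : ℝ → ℝ := fun t => |f (γ t) - (θ i).eval (γ t)| - ε / 2 * (1 - t) with hw
  have hwc : ContinuousOn w (Icc 0 1) := by
    have h1 : ContinuousOn (fun t => f (γ t)) (Icc 0 1) := hf.comp hγc.continuousOn hγC
    have h2 : Continuous (fun t => (θ i).eval (γ t)) := (θ i).continuous_eval.comp hγc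
    exact (h1.sub h2.continuousOn).abs.sub (by fun_prop)
  have h0 : γ 0 = p := by simp [hγ]
  have h1 : γ 1 = b := by simp [hγ]
  have hw0 : w 0 ≤ 0 := by simp only [hw, h0, hi]; simp; positivity
  have hw1 : 0 < w 1 := by
    simp only [hw, h1]
    simpa [sub_eq_zero] using hbne
  obtain ⟨t, ht, hwt⟩ := intermediate_value_Icc zero_le_one hwc ⟨hw0, hw1.le⟩
  have ht1 : t < 1 := by
    rcases ht.2.lt_or_eq with h | h
    · exact h
    · rw [h] at hwt
      exact absurd hwt hw1.ne'
  obtain ⟨j, hj⟩ := hsel _ (hγC t ht)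
  have hwt' : |f (γ t) - (θ i).eval (γ t)| = ε / 2 * (1 - t) := by
    have : |f (γ t) - (θ i).eval (γ t)| - ε / 2 * (1 - t) = 0 := hwt
    linarith
  rw [hj, hγe t ht, hγe t ht] at hwt'
  have hpos : 0 < ε * (1 - t) := mul_pos hε (sub_pos.2 ht1)
  by_cases hpj : (θ j).eval p = (θ i).eval p
  · have hall : ∀ q ∈ C, (θ j).eval q = (θ i).eval q := fun q hq =>
      by_contra fun hne => hgen (j, i) (Finset.mem_univ _) ⟨q, hq, hne⟩ hpj
    rw [hpj, hall b hb, sub_self, abs_zero] at hwt'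
    linarith
  · have h2 := hεj j hpj
    have ht0 := ht.1
    have h3 : (1 - t) * |(θ j).eval p - (θ i).eval p| ≤
        |(1 - t) * (θ j).eval p + t * (θ j).eval b -
          ((1 - t) * (θ i).eval p + t * (θ i).eval b)| := by
      have hs : (1 - t) * (θ j).eval p + t * (θ j).eval b -
          ((1 - t) * (θ i).eval p + t * (θ i).eval b) =
          (1 - t) * ((θ j).eval p - (θ i).eval p) + t * ((θ j).eval b - (θ i).eval b) := by ring
      rw [hs]
      rcases hcmp j i with h | h
      · have e1 := h p hp
        have e2 := mul_nonneg ht0 (sub_nonneg.2 (h b hb))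
        rw [abs_of_nonpos (by linarith), abs_of_nonpos]
        · linarith
        · have := mul_nonneg (sub_pos.2 ht1).le (sub_nonneg.2 e1)
          linarith
      · have e1 := h p hp
        have e2 := mul_nonneg ht0 (sub_nonneg.2 (h b hb))
        rw [abs_of_nonneg (by linarith), abs_of_nonneg]
        · linarith
        · have := mul_nonneg (sub_pos.2 ht1).le (sub_nonneg.2 e1)
          linarith
    have h4 := mul_le_mul_of_nonneg_left h2 (sub_pos.2 ht1).le
    linarith

open Classical in
/-- The order pattern of a valuation with respect to a family of affine forms. -/
noncomputable def orderPattern {ι : Type*} (θ : ι → AffineForm X) (ν : Valuation X) :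
    ι → ι → Bool :=
  fun i j => decide ((θ i).eval ν ≤ (θ j).eval ν)

/-- The closed polyhedron of a pattern: the sign conditions on the differences of the forms that
the pattern prescribes, made non-strict. -/
def cell {ι : Type*} (θ : ι → AffineForm X) (s : ι → ι → Bool) : Set (Valuation X) :=
  {ν | ∀ i j, if s i j then (θ i).eval ν ≤ (θ j).eval ν else (θ j).eval ν ≤ (θ i).eval ν}

lemma mem_cell_orderPattern {ι : Type*} (θ : ι → AffineForm X) (ν : Valuation X) :
    ν ∈ cell θ (orderPattern θ ν) := by
  intro i j
  by_cases h : (θ i).eval ν ≤ (θ j).eval ν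
  · simp [orderPattern, h]
  · simp [orderPattern, h, (not_le.1 h).le]

lemma convex_cell {ι : Type*} (θ : ι → AffineForm X) (s : ι → ι → Bool) :
    Convex ℝ≥0 (cell θ s) := by
  intro μ hμ ν hν a b _ _ hab i j
  have h1 := hμ i j
  have h2 := hν i j
  rw [AffineForm.eval_combo _ _ _ hab, AffineForm.eval_combo _ _ _ hab]
  split_ifs at h1 h2 ⊢ <;> gcongr

/-- A continuous selection of finitely many affine forms on a convex set is given on each cell by
one form. -/
lemma exists_form_on_cells {ι : Type*} [Finite ι] [Nonempty ι] (θ : ι → AffineForm X)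
    {D : Set (Valuation X)} (hD : Convex ℝ≥0 D) {f : Valuation X → ℝ} (hf : ContinuousOn f D)
    (hsel : ∀ ν ∈ D, ∃ i, f ν = (θ i).eval ν) :
    ∃ c : (ι → ι → Bool) → ι, ∀ s, ∀ ν ∈ D, ν ∈ cell θ s → f ν = (θ (c s)).eval ν := by
  have h : ∀ s : ι → ι → Bool, ∃ i, ∀ ν ∈ D, ν ∈ cell θ s → f ν = (θ i).eval ν := by
    intro s
    by_cases hne : (D ∩ cell θ s).Nonempty
    · obtain ⟨i, hi⟩ := exists_form_of_selection θ (hD.inter (convex_cell θ s)) hne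
        (fun i j => by
          cases hs : s i j
          · exact Or.inr fun ν hν => by simpa [hs] using hν.2 i j
          · exact Or.inl fun ν hν => by simpa [hs] using hν.2 i j)
        (hf.mono inter_subset_left) (fun ν hν => hsel ν hν.1)
      exact ⟨i, fun ν h1 h2 => hi ν ⟨h1, h2⟩⟩
    · exact ⟨Classical.arbitrary ι, fun ν h1 h2 => absurd ⟨ν, h1, h2⟩ hne⟩
  choose c hc using h
  exact ⟨c, hc⟩

/-- `f` is on `D` a continuous selection of the forms in `Θ`. -/
def IsFormSelection (Θ : Set (AffineForm X)) (D : Set (Valuation X)) (f : Valuation X → ℝ) :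
    Prop :=
  ContinuousOn f D ∧ ∀ ν ∈ D, ∃ θ ∈ Θ, f ν = θ.eval ν

lemma IsFormSelection.piecewiseLinearOver {Θ : Set (AffineForm X)} (hΘ : Θ.Finite)
    {K : Subfield ℝ} (hK : ∀ θ ∈ Θ, θ.Over K) {D : Set (Valuation X)} (hD : Convex ℝ≥0 D)
    (hne : D.Nonempty) {f : Valuation X → ℝ} (hf : IsFormSelection Θ D f) :
    PiecewiseLinearOver K f D := by
  classical
  have := hΘ.to_subtype
  have := Fintype.ofFinite Θ
  obtain ⟨ν₀, hν₀⟩ := hne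
  obtain ⟨θ₀, hθ₀, -⟩ := hf.2 ν₀ hν₀
  have : Nonempty Θ := ⟨⟨θ₀, hθ₀⟩⟩
  obtain ⟨c, hc⟩ := exists_form_on_cells (fun θ : Θ => (θ : AffineForm X)) hD hf.1
    (fun ν hν => by
      obtain ⟨θ, hθ, h⟩ := hf.2 ν hν
      exact ⟨⟨θ, hθ⟩, h⟩)
  let e := Fintype.equivFin (Θ → Θ → Bool)
  let diff : AffineForm X → AffineForm X → AffineForm X := fun a b =>
    ⟨fun x => b.coeff x - a.coeff x, b.const - a.const⟩
  have hdiff : ∀ a b ν, (diff a b).eval ν = b.eval ν - a.eval ν := by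
    intro a b ν
    simp only [diff, AffineForm.eval, sub_mul, Finset.sum_sub_distrib]
    ring
  have hdiffK : ∀ a b : AffineForm X, a.Over K → b.Over K → (diff a b).Over K :=
    fun a b ha hb => ⟨fun x => sub_mem (hb.1 x) (ha.1 x), sub_mem hb.2 ha.2⟩
  have hcell : ∀ i ν, (∀ h ∈ (Finset.univ.image fun k : Θ × Θ =>
      if e.symm i k.1 k.2 then diff k.1 k.2 else diff k.2 k.1), 0 ≤ h.eval ν) ↔
      ν ∈ cell (fun θ : Θ => (θ : AffineForm X)) (e.symm i) := by
    intro i ν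
    simp only [Finset.forall_mem_image, Finset.mem_univ, forall_const, Prod.forall, cell,
      mem_ofPred_eq]
    refine forall_congr' fun a => forall_congr' fun b => ?_
    split_ifs <;> rw [hdiff, sub_nonneg]
  refine ⟨_, fun i => Finset.univ.image fun k : Θ × Θ =>
    if e.symm i k.1 k.2 then diff k.1 k.2 else diff k.2 k.1, fun i => c (e.symm i), ?_, ?_, ?_, ?_⟩
  · intro i h hh
    simp only [Finset.mem_image, Finset.mem_univ, true_and] at hh
    obtain ⟨k, rfl⟩ := hh
    split_ifs
    · exact hdiffK _ _ (hK _ k.1.2) (hK _ k.2.2)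
    · exact hdiffK _ _ (hK _ k.2.2) (hK _ k.1.2)
  · exact fun i => hK _ (c _).2
  · intro ν _
    refine ⟨e (orderPattern (fun θ : Θ => (θ : AffineForm X)) ν), ?_⟩
    rw [hcell, Equiv.symm_apply_apply]
    exact mem_cell_orderPattern _ ν
  · intro i ν hν h
    rw [hcell] at h
    exact hc _ ν hν h

/-- There are only finitely many continuous selections of a finite set of affine forms. -/
lemma finite_isFormSelection {Θ : Set (AffineForm X)} (hΘ : Θ.Finite) {D : Set (Valuation X)}
    (hD : Convex ℝ≥0 D) (hne : D.Nonempty) :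
    {F : D → ℝ | ∃ f, IsFormSelection Θ D f ∧ ∀ ν : D, F ν = f ν}.Finite := by
  classical
  have := hΘ.to_subtype
  refine (Set.finite_range fun (c : (Θ → Θ → Bool) → Θ) (ν : D) =>
    (c (orderPattern (fun θ : Θ => (θ : AffineForm X)) ν) : AffineForm X).eval ν).subset ?_
  rintro F ⟨f, hf, hF⟩
  obtain ⟨ν₀, hν₀⟩ := hne
  obtain ⟨θ₀, hθ₀, -⟩ := hf.2 ν₀ hν₀
  have : Nonempty Θ := ⟨⟨θ₀, hθ₀⟩⟩
  obtain ⟨c, hc⟩ := exists_form_on_cells (fun θ : Θ => (θ : AffineForm X)) hD hf.1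
    (fun ν hν => by
      obtain ⟨θ, hθ, h⟩ := hf.2 ν hν
      exact ⟨⟨θ, hθ⟩, h⟩)
  exact ⟨c, funext fun ν => by rw [hF, hc _ ν ν.2 (mem_cell_orderPattern _ _)]⟩

end Cells

/-! ### Families of affine functions on the unit interval and on the triangle -/

/-- `f` is continuous, and on `D` it is a selection of the functions in `Θ`. -/
def IsSelection {α : Type*} [TopologicalSpace α] (Θ : Set (α → ℝ)) (D : Set α) (f : α → ℝ) :
    Prop :=
  Continuous f ∧ ∀ p ∈ D, ∃ θ ∈ Θ, f p = θ p

namespace IsSelection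

variable {α : Type*} [TopologicalSpace α] {Θ Θ' : Set (α → ℝ)} {D : Set α} {f g : α → ℝ}

lemma min (hf : IsSelection Θ D f) (hg : IsSelection Θ D g) :
    IsSelection Θ D (fun p => f p ⊓ g p) := by
  refine ⟨hf.1.min hg.1, fun p hp => ?_⟩
  rcases min_choice (f p) (g p) with h | h <;> simp only [h]
  exacts [hf.2 p hp, hg.2 p hp]

lemma neg (hΘ : ∀ θ ∈ Θ, (fun p => -θ p) ∈ Θ) (hf : IsSelection Θ D f) :
    IsSelection Θ D (fun p => -f p) := by
  refine ⟨hf.1.neg, fun p hp => ?_⟩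
  obtain ⟨θ, hθ, h⟩ := hf.2 p hp
  exact ⟨_, hΘ θ hθ, by simp only [h]⟩

lemma mono (h : Θ ⊆ Θ') (hf : IsSelection Θ D f) : IsSelection Θ' D f :=
  ⟨hf.1, fun p hp => (hf.2 p hp).imp fun _ hθ => ⟨h hθ.1, hθ.2⟩⟩

end IsSelection

/-- `φ` is an affine function of one variable with coefficients in `K`. -/
def IsAffine₁ (K : Subfield ℝ) (φ : ℝ → ℝ) : Prop :=
  ∃ m ∈ K, ∃ c ∈ K, ∀ z, φ z = m * z + c

/-- `ψ` is an affine function of two variables with coefficients in `K`. -/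
def IsAffine₂ (K : Subfield ℝ) (ψ : ℝ × ℝ → ℝ) : Prop :=
  ∃ p ∈ K, ∃ q ∈ K, ∃ r ∈ K, ∀ u, ψ u = p * u.1 + q * u.2 + r

/-- The closed triangle `0 ≤ a ≤ b ≤ 1`. -/
def triangle : Set (ℝ × ℝ) := {p | 0 ≤ p.1 ∧ p.1 ≤ p.2 ∧ p.2 ≤ 1}

/-- The point at proportion `t` of the diagonal segment from `p` up to the side `b = 1`. -/
def diag (p : ℝ × ℝ) (t : ℝ) : ℝ × ℝ := (p.1 + t * (1 - p.2), p.2 + t * (1 - p.2))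

lemma diag_zero (p : ℝ × ℝ) : diag p 0 = p := by simp [diag]

lemma diag_one (p : ℝ × ℝ) : diag p 1 = (1 - (p.2 - p.1), 1) := by
  simp only [diag, Prod.mk.injEq]
  constructor <;> ring

lemma diag_sub (p : ℝ × ℝ) (t : ℝ) : (diag p t).2 - (diag p t).1 = p.2 - p.1 := by
  simp only [diag]; ring

lemma diag_diag (p : ℝ × ℝ) (s t : ℝ) : diag (diag p t) s = diag p (t + s * (1 - t)) := by
  simp only [diag, Prod.mk.injEq]
  constructor <;> ring

lemma diag_mem {p : ℝ × ℝ} (hp : p ∈ triangle) {t : ℝ} (ht : t ∈ Icc (0 : ℝ) 1) :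
    diag p t ∈ triangle := by
  obtain ⟨h1, h2, h3⟩ := hp
  have h4 : 0 ≤ t * (1 - p.2) := mul_nonneg ht.1 (by linarith)
  have h5 : t * (1 - p.2) ≤ 1 * (1 - p.2) := mul_le_mul_of_nonneg_right ht.2 (by linarith)
  refine ⟨?_, ?_, ?_⟩ <;> simp only [diag] <;> linarith

lemma continuous_diag : Continuous fun q : (ℝ × ℝ) × ℝ => diag q.1 q.2 := by
  unfold diag
  fun_prop

/-- The infimum of `g` over the future of `p`, that is, along the diagonal above `p`. -/
noncomputable def futureInf (g : ℝ × ℝ → ℝ) (p : ℝ × ℝ) : ℝ :=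
  sInf ((fun t => g (diag p t)) '' Icc 0 1)

section FutureInf

variable {g : ℝ × ℝ → ℝ}

lemma continuous_along_diag (hg : Continuous g) (p : ℝ × ℝ) : Continuous fun t => g (diag p t) :=
  hg.comp (continuous_diag.comp (by fun_prop : Continuous fun t : ℝ => (p, t)))

lemma continuous_futureInf (hg : Continuous g) : Continuous (futureInf g) :=
  isCompact_Icc.continuous_sInf (hg.comp continuous_diag)

lemma exists_futureInf_eq (hg : Continuous g) (p : ℝ × ℝ) :
    ∃ t ∈ Icc (0 : ℝ) 1, futureInf g p = g (diag p t) ∧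
      ∀ s ∈ Icc (0 : ℝ) 1, g (diag p t) ≤ g (diag p s) := by
  obtain ⟨t, ht, h1, h2⟩ := isCompact_Icc.exists_sInf_image_eq_and_le (nonempty_Icc.2 zero_le_one)
    (continuous_along_diag hg p).continuousOn
  exact ⟨t, ht, h1, h2⟩

lemma futureInf_le (hg : Continuous g) (p : ℝ × ℝ) {t : ℝ} (ht : t ∈ Icc (0 : ℝ) 1) :
    futureInf g p ≤ g (diag p t) := by
  obtain ⟨s, _, h1, h2⟩ := exists_futureInf_eq hg p
  rw [h1]
  exact h2 t ht

lemma futureInf_le_diag (hg : Continuous g) (p : ℝ × ℝ) {t : ℝ} (ht : t ∈ Icc (0 : ℝ) 1) :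
    futureInf g p ≤ futureInf g (diag p t) := by
  obtain ⟨s, hs, h1, -⟩ := exists_futureInf_eq hg (diag p t)
  rw [h1, diag_diag]
  refine futureInf_le hg p ⟨?_, ?_⟩
  · have := mul_nonneg hs.1 (sub_nonneg.2 ht.2)
    linarith [ht.1]
  · have := mul_le_mul_of_nonneg_right hs.2 (sub_nonneg.2 ht.2)
    linarith

/-- The future infimum of a continuous selection of affine functions is again a selection: its
value is the value of a member at the point itself, at the end of the diagonal, or at a crossing of
two members with different slopes along the diagonal. -/
lemma isSelection_futureInf {K : Subfield ℝ} {Ψ Ψ' : Set (ℝ × ℝ → ℝ)} (hfin : Ψ.Finite)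
    (haff : ∀ ψ ∈ Ψ, IsAffine₂ K ψ) (hsub : Ψ ⊆ Ψ')
    (hend : ∀ ψ ∈ Ψ, (fun p : ℝ × ℝ => ψ (1 - (p.2 - p.1), 1)) ∈ Ψ')
    (hcross : ∀ ψ ∈ Ψ, ∀ ψ' ∈ Ψ, ψ (1, 1) - ψ (0, 0) ≠ ψ' (1, 1) - ψ' (0, 0) →
      ∃ χ ∈ Ψ', ∀ p ∈ triangle, ∀ t ∈ Icc (0 : ℝ) 1,
        ψ (diag p t) = ψ' (diag p t) → χ p = ψ (diag p t))
    (hg : IsSelection Ψ triangle g) : IsSelection Ψ' triangle (futureInf g) := by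
  refine ⟨continuous_futureInf hg.1, fun p hp => ?_⟩
  have hline : ∀ ψ ∈ Ψ, ∀ t,
      ψ (diag p t) = (1 - p.2) * (ψ (1, 1) - ψ (0, 0)) * t + ψ p := by
    intro ψ hψ t
    obtain ⟨a, _, b, _, c, _, h⟩ := haff ψ hψ
    simp only [h, diag]
    ring
  obtain ⟨t, ht, h1, h2⟩ := exists_futureInf_eq hg.1 p
  rw [h1]
  rcases eq_or_ne t 0 with rfl | h0
  · rw [diag_zero]
    obtain ⟨ψ, hψ, h⟩ := hg.2 p hp
    exact ⟨ψ, hsub hψ, h⟩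
  rcases eq_or_ne t 1 with rfl | h1'
  · obtain ⟨ψ, hψ, h⟩ := hg.2 _ (diag_mem hp ht)
    exact ⟨_, hend ψ hψ, by rw [h, diag_one]⟩
  have ht' : t ∈ Ioo (0 : ℝ) 1 := ⟨lt_of_le_of_ne ht.1 (Ne.symm h0), lt_of_le_of_ne ht.2 h1'⟩
  rcases exists_crossing_of_isLocalMin
    (Θ := (fun ψ : ℝ × ℝ → ℝ => ((1 - p.2) * (ψ (1, 1) - ψ (0, 0)), ψ p)) '' Ψ)
    (hfin.image _) (u := fun t => g (diag p t)) (continuous_along_diag hg.1 p).continuousOn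
    (by
      intro r hr
      obtain ⟨ψ, hψ, h⟩ := hg.2 _ (diag_mem hp hr)
      exact ⟨_, ⟨ψ, hψ, rfl⟩, by simp only [h, hline ψ hψ r]⟩)
    ht' h2 with ⟨_, ⟨ψ, hψ, rfl⟩, _, h⟩ | ⟨_, ⟨ψ, hψ, rfl⟩, _, ⟨ψ', hψ', rfl⟩, hne, h, h'⟩
  · exact ⟨ψ, hsub hψ, h.symm⟩
  · simp only [← hline _ hψ, ← hline _ hψ'] at h h'
    obtain ⟨χ, hχ, hχ'⟩ := hcross ψ hψ ψ' hψ' (fun heq => hne (by simp only [heq]))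
    exact ⟨χ, hχ, by rw [hχ' p hp t ht (h.trans h'.symm), h]⟩

end FutureInf

/-- A pair of finite families of affine functions over `K`, of one and of two variables, with the
closure properties that make value iteration stay within their continuous selections. The
functions of one variable describe values at configurations with an integral clock; the family
`Ψ₀` describes output functions on open regions, and its members enter the other family through
their restrictions to the sides `a = 0` and `b = 1` of the triangle and through their crossing
values along the diagonals. -/
structure IsClosedFamily (K : Subfield ℝ) (Φ : Set (ℝ → ℝ)) (Ψ₀ : Set (ℝ × ℝ → ℝ)) : Prop where
  finite₁ : Φ.Finite
  affine₁ : ∀ φ ∈ Φ, IsAffine₁ K φ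
  neg₁ : ∀ φ ∈ Φ, (fun z => -φ z) ∈ Φ
  refl₁ : ∀ φ ∈ Φ, (fun z => φ (1 - z)) ∈ Φ
  const₁ : ∀ φ ∈ Φ, (fun _ => φ 0) ∈ Φ
  cross₁ : ∀ φ ∈ Φ, ∀ φ' ∈ Φ, φ 1 - φ 0 ≠ φ' 1 - φ' 0 → ∀ z, φ z = φ' z → (fun _ => φ z) ∈ Φ
  finite₂ : Ψ₀.Finite
  affine₂ : ∀ ψ ∈ Ψ₀, IsAffine₂ K ψ
  neg₂ : ∀ ψ ∈ Ψ₀, (fun p => -ψ p) ∈ Ψ₀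
  start₂ : ∀ ψ ∈ Ψ₀, (fun z => ψ (0, z)) ∈ Φ
  end₂ : ∀ ψ ∈ Ψ₀, (fun z => ψ (1 - z, 1)) ∈ Φ
  cross₂ : ∀ ψ ∈ Ψ₀, ∀ ψ' ∈ Ψ₀, ψ (1, 1) - ψ (0, 0) ≠ ψ' (1, 1) - ψ' (0, 0) →
    ∃ φ ∈ Φ, ∀ p t, ψ (diag p t) = ψ' (diag p t) → φ (p.2 - p.1) = ψ (diag p t)

/-- Reflection `z ↦ 1 - z` and negation are commuting involutions, so a family becomes closed under
both when its images are added once. -/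
lemma exists_symmetric_family {K : Subfield ℝ} {Φ : Set (ℝ → ℝ)} (hfin : Φ.Finite)
    (haff : ∀ φ ∈ Φ, IsAffine₁ K φ) :
    ∃ Φ' : Set (ℝ → ℝ), Φ ⊆ Φ' ∧ Φ'.Finite ∧ (∀ φ ∈ Φ', IsAffine₁ K φ) ∧
      (∀ φ ∈ Φ', (fun z => -φ z) ∈ Φ') ∧ ∀ φ ∈ Φ', (fun z => φ (1 - z)) ∈ Φ' := by
  let r : (ℝ → ℝ) → ℝ → ℝ := fun φ z => φ (1 - z)
  let n : (ℝ → ℝ) → ℝ → ℝ := fun φ z => -φ z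
  have hrr : ∀ φ, r (r φ) = φ := fun φ => by funext z; simp [r]
  have hnn : ∀ φ, n (n φ) = φ := fun φ => by funext z; simp [n]
  have hrn : ∀ φ, r (n φ) = n (r φ) := fun φ => rfl
  have hr : ∀ φ, IsAffine₁ K φ → IsAffine₁ K (r φ) := by
    rintro φ ⟨m, hm, c, hc, h⟩
    exact ⟨-m, neg_mem hm, m + c, add_mem hm hc, fun z => by simp only [r, h]; ring⟩
  have hn : ∀ φ, IsAffine₁ K φ → IsAffine₁ K (n φ) := by
    rintro φ ⟨m, hm, c, hc, h⟩
    exact ⟨-m, neg_mem hm, -c, neg_mem hc, fun z => by simp only [n, h]; ring⟩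
  refine ⟨(Φ ∪ r '' Φ) ∪ n '' (Φ ∪ r '' Φ), fun φ h => Or.inl (Or.inl h), ?_, ?_, ?_, ?_⟩
  · exact (hfin.union (hfin.image _)).union ((hfin.union (hfin.image _)).image _)
  · rintro _ ((h | ⟨φ, h, rfl⟩) | ⟨_, (h | ⟨φ, h, rfl⟩), rfl⟩)
    exacts [haff _ h, hr _ (haff _ h), hn _ (haff _ h), hn _ (hr _ (haff _ h))]
  · rintro φ (h | ⟨φ, h, rfl⟩)
    · exact Or.inr ⟨φ, h, rfl⟩
    · refine Or.inl ?_
      change n (n φ) ∈ _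
      rwa [hnn]
  · have h1 : ∀ φ ∈ Φ ∪ r '' Φ, r φ ∈ Φ ∪ r '' Φ := by
      rintro φ (h | ⟨φ, h, rfl⟩)
      · exact Or.inr ⟨φ, h, rfl⟩
      · exact Or.inl ((hrr φ).symm ▸ h)
    rintro φ (h | ⟨φ, h, rfl⟩)
    · exact Or.inl (h1 φ h)
    · exact Or.inr ⟨r φ, h1 φ h, rfl⟩

/-- The crossing of two affine functions along a diagonal has a value that is an affine function
of the difference of the coordinates. -/
lemma exists_crossing_form {K : Subfield ℝ} {ψ ψ' : ℝ × ℝ → ℝ} (hψ : IsAffine₂ K ψ)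
    (hψ' : IsAffine₂ K ψ') : ∃ φ, IsAffine₁ K φ ∧
      (ψ (1, 1) - ψ (0, 0) ≠ ψ' (1, 1) - ψ' (0, 0) →
        ∀ p t, ψ (diag p t) = ψ' (diag p t) → φ (p.2 - p.1) = ψ (diag p t)) := by
  obtain ⟨a, ha, b, hb, c, hc, h⟩ := hψ
  obtain ⟨a', ha', b', hb', c', hc', h'⟩ := hψ'
  have hab := add_mem ha hb
  have hd := sub_mem hab (add_mem ha' hb')
  refine ⟨fun z => ((a + b) * (a - a') / (a + b - (a' + b')) - a) * z +
      (c - (a + b) * (c - c') / (a + b - (a' + b'))),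
    ⟨_, sub_mem (div_mem (mul_mem hab (sub_mem ha ha')) hd) ha, _,
      sub_mem hc (div_mem (mul_mem hab (sub_mem hc hc')) hd), fun z => rfl⟩, ?_⟩
  intro hne p t heq
  have hne' : a + b - (a' + b') ≠ 0 := by
    intro h0
    apply hne
    simp only [h, h']
    linarith
  rw [← diag_sub p t]
  set q := diag p t
  rw [h, h'] at heq
  rw [h]
  field_simp
  linear_combination (-(a + b)) * heq

/-- Every finite family lies in a closed one. The constants that closure asks for are the values at
the ends of the interval and the crossing values of the given functions; a crossing with one of
these constants has a value that is already present, so the process stops after one round. -/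
lemma exists_closedFamily {K : Subfield ℝ} {Φ : Set (ℝ → ℝ)} {Ψ : Set (ℝ × ℝ → ℝ)}
    (hΦ : Φ.Finite) (hΦK : ∀ φ ∈ Φ, IsAffine₁ K φ) (hΨ : Ψ.Finite)
    (hΨK : ∀ ψ ∈ Ψ, IsAffine₂ K ψ) :
    ∃ Φ' Ψ', IsClosedFamily K Φ' Ψ' ∧ Φ ⊆ Φ' ∧ Ψ ⊆ Ψ' := by
  let n : (ℝ × ℝ → ℝ) → ℝ × ℝ → ℝ := fun ψ p => -ψ p
  obtain ⟨Ψ', hΨ'⟩ : ∃ Ψ', Ψ' = Ψ ∪ n '' Ψ := ⟨_, rfl⟩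
  have hfin₂ : Ψ'.Finite := hΨ' ▸ hΨ.union (hΨ.image _)
  have haff₂ : ∀ ψ ∈ Ψ', IsAffine₂ K ψ := by
    rw [hΨ']
    rintro _ (h | ⟨ψ, h, rfl⟩)
    · exact hΨK _ h
    · obtain ⟨a, ha, b, hb, c, hc, h⟩ := hΨK _ h
      exact ⟨-a, neg_mem ha, -b, neg_mem hb, -c, neg_mem hc, fun u => by simp only [n, h]; ring⟩
  have hneg₂ : ∀ ψ ∈ Ψ', (fun p => -ψ p) ∈ Ψ' := by
    rw [hΨ']
    rintro _ (h | ⟨ψ, h, rfl⟩)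
    · exact Or.inr ⟨_, h, rfl⟩
    · exact Or.inl (by simpa [n] using h)
  choose! x hx hx' using fun (ψ : ℝ × ℝ → ℝ) (h : IsAffine₂ K ψ) (ψ' : ℝ × ℝ → ℝ)
    (h' : IsAffine₂ K ψ') => exists_crossing_form h h'
  let s : (ℝ × ℝ → ℝ) → ℝ → ℝ := fun ψ z => ψ (0, z)
  let e : (ℝ × ℝ → ℝ) → ℝ → ℝ := fun ψ z => ψ (1 - z, 1)
  obtain ⟨Φ₁, hsub, hfin₁, haff₁, hneg₁, hrefl₁⟩ := exists_symmetric_family (K := K)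
    (Φ := (Φ ∪ s '' Ψ') ∪ (e '' Ψ' ∪ Set.image2 x Ψ' Ψ'))
    ((hΦ.union (hfin₂.image _)).union ((hfin₂.image _).union (hfin₂.image2 _ hfin₂)))
    (by
      rintro _ ((h | ⟨ψ, h, rfl⟩) | (⟨ψ, h, rfl⟩ | ⟨ψ, h, ψ', h', rfl⟩))
      · exact hΦK _ h
      · obtain ⟨a, ha, b, hb, c, hc, h⟩ := haff₂ _ h
        exact ⟨b, hb, c, hc, fun z => by simp only [s, h]; ring⟩
      · obtain ⟨a, ha, b, hb, c, hc, h⟩ := haff₂ _ h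
        exact ⟨-a, neg_mem ha, a + b + c, add_mem (add_mem ha hb) hc,
          fun z => by simp only [e, h]; ring⟩
      · exact hx _ (haff₂ _ h) _ (haff₂ _ h'))
  -- the crossing values and the values at the ends of the interval
  let V : Set ℝ := {v | ∃ φ ∈ Φ₁, v = φ 0} ∪
    {v | ∃ φ ∈ Φ₁, ∃ φ' ∈ Φ₁, φ 1 - φ 0 ≠ φ' 1 - φ' 0 ∧ ∃ z, φ z = φ' z ∧ v = φ z}
  have hcr : ∀ φ ∈ Φ₁, ∀ φ' ∈ Φ₁, φ 1 - φ 0 ≠ φ' 1 - φ' 0 → ∀ z, φ z = φ' z →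
      φ z = (φ 1 - φ 0) * ((φ' 0 - φ 0) / (φ 1 - φ 0 - (φ' 1 - φ' 0))) + φ 0 := by
    intro φ hφ φ' hφ' hne z heq
    obtain ⟨m, hm, c, hc, h⟩ := haff₁ _ hφ
    obtain ⟨m', hm', c', hc', h'⟩ := haff₁ _ hφ'
    simp only [h, h'] at heq hne ⊢
    have hne' : m - m' ≠ 0 := fun h0 => hne (by linarith)
    have : m * 1 + c - (m * 0 + c) - (m' * 1 + c' - (m' * 0 + c')) = m - m' := by ring
    rw [this]
    field_simp
    linear_combination m * heq
  have hVfin : V.Finite := by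
    refine (hfin₁.image fun φ => φ 0).union
      (hfin₁.image2 (fun φ φ' => (φ 1 - φ 0) *
        ((φ' 0 - φ 0) / (φ 1 - φ 0 - (φ' 1 - φ' 0))) + φ 0) hfin₁) |>.subset ?_
    rintro v (⟨φ, hφ, rfl⟩ | ⟨φ, hφ, φ', hφ', hne, z, heq, rfl⟩)
    · exact Or.inl ⟨φ, hφ, rfl⟩
    · exact Or.inr ⟨φ, hφ, φ', hφ', (hcr φ hφ φ' hφ' hne z heq).symm⟩
  have hval : ∀ φ ∈ Φ₁, φ 0 ∈ K ∧ φ 1 ∈ K := by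
    intro φ hφ
    obtain ⟨m, hm, c, hc, h⟩ := haff₁ _ hφ
    rw [h, h]
    exact ⟨by simpa using hc, by simpa using add_mem hm hc⟩
  have hVK : ∀ v ∈ V, v ∈ K := by
    rintro v (⟨φ, hφ, rfl⟩ | ⟨φ, hφ, φ', hφ', hne, z, heq, rfl⟩)
    · exact (hval φ hφ).1
    · obtain ⟨h1, h2⟩ := hval φ hφ
      obtain ⟨h3, h4⟩ := hval φ' hφ'
      rw [hcr φ hφ φ' hφ' hne z heq]
      exact add_mem (mul_mem (sub_mem h2 h1)
        (div_mem (sub_mem h3 h1) (sub_mem (sub_mem h2 h1) (sub_mem h4 h3)))) h1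
  have hVneg : ∀ v ∈ V, -v ∈ V := by
    rintro v (⟨φ, hφ, rfl⟩ | ⟨φ, hφ, φ', hφ', hne, z, heq, rfl⟩)
    · exact Or.inl ⟨_, hneg₁ φ hφ, rfl⟩
    · exact Or.inr ⟨_, hneg₁ φ hφ, _, hneg₁ φ' hφ', fun h => hne (by linarith), z, by
        simp only [heq], rfl⟩
  let k : ℝ → ℝ → ℝ := fun v _ => v
  have hΦ₁ : ∀ φ ∈ Φ₁, φ ∈ Φ₁ ∪ k '' V := fun φ h => Or.inl h
  refine ⟨Φ₁ ∪ k '' V, Ψ', ⟨?_, ?_, ?_, ?_, ?_, ?_, hfin₂, haff₂, hneg₂, ?_, ?_, ?_⟩, ?_, ?_⟩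
  · exact hfin₁.union (hVfin.image _)
  · rintro _ (h | ⟨v, h, rfl⟩)
    · exact haff₁ _ h
    · exact ⟨0, zero_mem K, v, hVK v h, fun z => by simp [k]⟩
  · rintro _ (h | ⟨v, h, rfl⟩)
    · exact Or.inl (hneg₁ _ h)
    · exact Or.inr ⟨-v, hVneg v h, rfl⟩
  · rintro _ (h | ⟨v, h, rfl⟩)
    · exact Or.inl (hrefl₁ _ h)
    · exact Or.inr ⟨v, h, rfl⟩
  · rintro φ (h | ⟨v, h, rfl⟩)
    · exact Or.inr ⟨φ 0, Or.inl ⟨φ, h, rfl⟩, rfl⟩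
    · exact Or.inr ⟨v, h, rfl⟩
  · rintro φ (h | ⟨v, h, rfl⟩) φ' (h' | ⟨v', h', rfl⟩) hne z heq
    · exact Or.inr ⟨φ z, Or.inr ⟨φ, h, φ', h', hne, z, heq, rfl⟩, rfl⟩
    · exact Or.inr ⟨v', h', by rw [heq]⟩
    · exact Or.inr ⟨v, h, rfl⟩
    · exact Or.inr ⟨v, h, rfl⟩
  · exact fun ψ h => Or.inl (hsub (Or.inl (Or.inr ⟨ψ, h, rfl⟩)))
  · exact fun ψ h => Or.inl (hsub (Or.inr (Or.inl ⟨ψ, h, rfl⟩)))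
  · exact fun ψ h ψ' h' hne => ⟨x ψ ψ', Or.inl (hsub (Or.inr (Or.inr ⟨ψ, h, ψ', h', rfl⟩))),
      hx' _ (haff₂ _ h) _ (haff₂ _ h') hne⟩
  · exact fun φ h => Or.inl (hsub (Or.inl (Or.inl h)))
  · exact fun ψ h => hΨ' ▸ Or.inl h

/-- All affine functions on the triangle `0 ≤ a ≤ b ≤ 1` that occur in value iteration. -/
def triangleForms (Φ : Set (ℝ → ℝ)) (Ψ₀ : Set (ℝ × ℝ → ℝ)) : Set (ℝ × ℝ → ℝ) :=
  (Ψ₀ ∪ (fun φ (p : ℝ × ℝ) => φ (p.2 - p.1)) '' Φ) ∪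
    ((fun φ (p : ℝ × ℝ) => φ p.2) '' Φ ∪ (fun φ (p : ℝ × ℝ) => φ p.1) '' Φ)

/-- The functions on the triangle whose future infimum and future supremum stay within the
continuous selections of `triangleForms`. -/
def Tame (Φ : Set (ℝ → ℝ)) (Ψ₀ : Set (ℝ × ℝ → ℝ)) (g : ℝ × ℝ → ℝ) : Prop :=
  IsSelection (triangleForms Φ Ψ₀) triangle g ∧
    IsSelection (triangleForms Φ Ψ₀) triangle (futureInf g) ∧
    IsSelection (triangleForms Φ Ψ₀) triangle (futureInf fun p => -g p)

/-- The functions on the triangle that are nondecreasing in time. These are the values at the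
locations of the minimizing player, who may always wait. -/
def Rising (Φ : Set (ℝ → ℝ)) (Ψ₀ : Set (ℝ × ℝ → ℝ)) (g : ℝ × ℝ → ℝ) : Prop :=
  IsSelection (triangleForms Φ Ψ₀) triangle g ∧
    ∀ p ∈ triangle, ∀ t ∈ Icc (0 : ℝ) 1, g p ≤ g (diag p t)

section ClosedFamily

variable {K : Subfield ℝ} {Φ : Set (ℝ → ℝ)} {Ψ₀ : Set (ℝ × ℝ → ℝ)} {f : ℝ → ℝ} {g : ℝ × ℝ → ℝ}

lemma IsClosedFamily.const_one (H : IsClosedFamily K Φ Ψ₀) {φ : ℝ → ℝ} (hφ : φ ∈ Φ) :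
    (fun _ => φ 1) ∈ Φ := by
  simpa using H.const₁ _ (H.refl₁ φ hφ)

lemma finite_triangleForms (H : IsClosedFamily K Φ Ψ₀) : (triangleForms Φ Ψ₀).Finite :=
  (H.finite₂.union (H.finite₁.image _)).union ((H.finite₁.image _).union (H.finite₁.image _))

lemma sub_mem_triangleForms {φ : ℝ → ℝ} (hφ : φ ∈ Φ) :
    (fun p : ℝ × ℝ => φ (p.2 - p.1)) ∈ triangleForms Φ Ψ₀ :=
  Or.inl (Or.inr ⟨φ, hφ, rfl⟩)

lemma snd_mem_triangleForms {φ : ℝ → ℝ} (hφ : φ ∈ Φ) :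
    (fun p : ℝ × ℝ => φ p.2) ∈ triangleForms Φ Ψ₀ :=
  Or.inr (Or.inl ⟨φ, hφ, rfl⟩)

lemma fst_mem_triangleForms {φ : ℝ → ℝ} (hφ : φ ∈ Φ) :
    (fun p : ℝ × ℝ => φ p.1) ∈ triangleForms Φ Ψ₀ :=
  Or.inr (Or.inr ⟨φ, hφ, rfl⟩)

lemma affine_triangleForms (H : IsClosedFamily K Φ Ψ₀) :
    ∀ ψ ∈ triangleForms Φ Ψ₀, IsAffine₂ K ψ := by
  rintro _ ((h | ⟨φ, h, rfl⟩) | (⟨φ, h, rfl⟩ | ⟨φ, h, rfl⟩))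
  · exact H.affine₂ _ h
  all_goals obtain ⟨m, hm, c, hc, h⟩ := H.affine₁ _ h
  · exact ⟨-m, neg_mem hm, m, hm, c, hc, fun u => by simp only [h]; ring⟩
  · exact ⟨0, zero_mem K, m, hm, c, hc, fun u => by simp only [h]; ring⟩
  · exact ⟨m, hm, 0, zero_mem K, c, hc, fun u => by simp only [h]; ring⟩

lemma neg_triangleForms (H : IsClosedFamily K Φ Ψ₀) :
    ∀ ψ ∈ triangleForms Φ Ψ₀, (fun p => -ψ p) ∈ triangleForms Φ Ψ₀ := by
  rintro _ ((h | ⟨φ, h, rfl⟩) | (⟨φ, h, rfl⟩ | ⟨φ, h, rfl⟩))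
  · exact Or.inl (Or.inl (H.neg₂ _ h))
  · exact sub_mem_triangleForms (H.neg₁ _ h)
  · exact snd_mem_triangleForms (H.neg₁ _ h)
  · exact fst_mem_triangleForms (H.neg₁ _ h)

lemma start_triangleForms (H : IsClosedFamily K Φ Ψ₀) :
    ∀ ψ ∈ triangleForms Φ Ψ₀, (fun z => ψ (0, z)) ∈ Φ := by
  rintro _ ((h | ⟨φ, h, rfl⟩) | (⟨φ, h, rfl⟩ | ⟨φ, h, rfl⟩))
  · exact H.start₂ _ h
  · simpa using h
  · exact h
  · exact H.const₁ _ h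

lemma end_triangleForms (H : IsClosedFamily K Φ Ψ₀) :
    ∀ ψ ∈ triangleForms Φ Ψ₀, (fun z => ψ (1 - z, 1)) ∈ Φ := by
  rintro _ ((h | ⟨φ, h, rfl⟩) | (⟨φ, h, rfl⟩ | ⟨φ, h, rfl⟩))
  · exact H.end₂ _ h
  · simpa using h
  · exact H.const_one h
  · exact H.refl₁ _ h

lemma isSelection_refl (H : IsClosedFamily K Φ Ψ₀) (hf : IsSelection Φ (Icc 0 1) f) :
    IsSelection Φ (Icc 0 1) (fun z => f (1 - z)) := by
  refine ⟨hf.1.comp (by fun_prop), fun z hz => ?_⟩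
  obtain ⟨φ, hφ, h⟩ := hf.2 (1 - z) ⟨by linarith [hz.2], by linarith [hz.1]⟩
  exact ⟨_, H.refl₁ φ hφ, h⟩

lemma isSelection_const_zero (H : IsClosedFamily K Φ Ψ₀) (hf : IsSelection Φ (Icc 0 1) f) :
    IsSelection Φ (Icc 0 1) (fun _ => f 0) := by
  refine ⟨continuous_const, fun z _ => ?_⟩
  obtain ⟨φ, hφ, h⟩ := hf.2 0 ⟨le_rfl, zero_le_one⟩
  exact ⟨_, H.const₁ φ hφ, h⟩

lemma isSelection_const_one (H : IsClosedFamily K Φ Ψ₀) (hf : IsSelection Φ (Icc 0 1) f) :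
    IsSelection Φ (Icc 0 1) (fun _ => f 1) := by
  simpa using isSelection_const_zero H (isSelection_refl H hf)

lemma isSelection_start (H : IsClosedFamily K Φ Ψ₀)
    (hg : IsSelection (triangleForms Φ Ψ₀) triangle g) :
    IsSelection Φ (Icc 0 1) (fun z => g (0, z)) := by
  refine ⟨hg.1.comp (by fun_prop), fun z hz => ?_⟩
  obtain ⟨ψ, hψ, h⟩ := hg.2 (0, z) ⟨le_rfl, hz.1, hz.2⟩
  exact ⟨_, start_triangleForms H ψ hψ, h⟩

lemma Rising.min {g' : ℝ × ℝ → ℝ} (hg : Rising Φ Ψ₀ g) (hg' : Rising Φ Ψ₀ g') :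
    Rising Φ Ψ₀ (fun p => g p ⊓ g' p) :=
  ⟨hg.1.min hg'.1, fun p hp t ht => inf_le_inf (hg.2 p hp t ht) (hg'.2 p hp t ht)⟩

lemma Rising.tame (H : IsClosedFamily K Φ Ψ₀) (hg : Rising Φ Ψ₀ g) : Tame Φ Ψ₀ g := by
  refine ⟨hg.1, ⟨continuous_futureInf hg.1.1, fun p hp => ?_⟩,
    ⟨continuous_futureInf hg.1.1.neg, fun p hp => ?_⟩⟩
  · obtain ⟨t, ht, h1, h2⟩ := exists_futureInf_eq hg.1.1 p
    have h3 := h2 0 ⟨le_rfl, zero_le_one⟩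
    rw [diag_zero] at h3
    rw [h1, le_antisymm h3 (hg.2 p hp t ht)]
    exact hg.1.2 p hp
  · have hc : Continuous fun p => -g p := hg.1.1.neg
    obtain ⟨t, ht, h1, h2⟩ := exists_futureInf_eq hc p
    have h3 := h2 1 ⟨zero_le_one, le_rfl⟩
    have h4 : g (diag p t) ≤ g (diag p 1) := by
      have := hg.2 (diag p t) (diag_mem hp ht) 1 ⟨zero_le_one, le_rfl⟩
      rwa [diag_diag, show t + 1 * (1 - t) = 1 by ring] at this
    rw [h1]
    rw [show -g (diag p t) = -g (diag p 1) by linarith]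
    obtain ⟨ψ, hψ, h⟩ := hg.1.2 _ (diag_mem hp ⟨zero_le_one, le_rfl⟩ : diag p 1 ∈ triangle)
    refine ⟨_, sub_mem_triangleForms (end_triangleForms H _ (neg_triangleForms H ψ hψ)), ?_⟩
    rw [h, diag_one]

lemma Tame.neg (H : IsClosedFamily K Φ Ψ₀) (hg : Tame Φ Ψ₀ g) : Tame Φ Ψ₀ (fun p => -g p) :=
  ⟨hg.1.neg (neg_triangleForms H), hg.2.2, by simpa using hg.2.1⟩

lemma Tame.rising_futureInf (hg : Tame Φ Ψ₀ g) : Rising Φ Ψ₀ (futureInf g) :=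
  ⟨hg.2.1, fun p _ _ ht => futureInf_le_diag hg.1.1 p ht⟩

/-- A function of the difference of the coordinates is constant in time. -/
lemma rising_sub (hf : IsSelection Φ (Icc 0 1) f) : Rising Φ Ψ₀ (fun p => f (p.2 - p.1)) := by
  refine ⟨⟨hf.1.comp (by fun_prop), fun p hp => ?_⟩,
    fun p _ t _ => by simp only [diag_sub, le_refl]⟩
  obtain ⟨φ, hφ, h⟩ := hf.2 (p.2 - p.1) ⟨by linarith [hp.2.1], by linarith [hp.1, hp.2.2]⟩
  exact ⟨_, sub_mem_triangleForms hφ, h⟩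

/-- It suffices for tameness that the future infimum is a selection for a family of forms that is
symmetric under negation. -/
lemma tame_of_isSelection (H : IsClosedFamily K Φ Ψ₀) {Ψ : Set (ℝ × ℝ → ℝ)}
    (hsub : Ψ ⊆ triangleForms Φ Ψ₀) (hneg : ∀ ψ ∈ Ψ, (fun p => -ψ p) ∈ Ψ)
    (hcross : ∀ ψ ∈ Ψ, ∀ ψ' ∈ Ψ, ψ (1, 1) - ψ (0, 0) ≠ ψ' (1, 1) - ψ' (0, 0) →
      ∃ χ ∈ triangleForms Φ Ψ₀, ∀ p ∈ triangle, ∀ t ∈ Icc (0 : ℝ) 1,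
        ψ (diag p t) = ψ' (diag p t) → χ p = ψ (diag p t))
    (hg : IsSelection Ψ triangle g) : Tame Φ Ψ₀ g := by
  have h : ∀ g, IsSelection Ψ triangle g →
      IsSelection (triangleForms Φ Ψ₀) triangle (futureInf g) := fun g hg =>
    isSelection_futureInf ((finite_triangleForms H).subset hsub)
      (fun ψ hψ => affine_triangleForms H ψ (hsub hψ)) hsub
      (fun ψ hψ => sub_mem_triangleForms (end_triangleForms H ψ (hsub hψ))) hcross hg
  exact ⟨hg.mono hsub, h g hg, h _ (hg.neg hneg)⟩

lemma tame_of_output (H : IsClosedFamily K Φ Ψ₀) (hg : IsSelection Ψ₀ triangle g) :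
    Tame Φ Ψ₀ g := by
  refine tame_of_isSelection H (fun ψ h => Or.inl (Or.inl h)) H.neg₂ ?_ hg
  intro ψ hψ ψ' hψ' hne
  obtain ⟨φ, hφ, h⟩ := H.cross₂ ψ hψ ψ' hψ' hne
  exact ⟨_, sub_mem_triangleForms hφ, fun p _ t _ => h p t⟩

lemma tame_snd (H : IsClosedFamily K Φ Ψ₀) (hf : IsSelection Φ (Icc 0 1) f) :
    Tame Φ Ψ₀ (fun p => f p.2) := by
  refine tame_of_isSelection H (Ψ := (fun φ (p : ℝ × ℝ) => φ p.2) '' Φ)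
    (fun ψ h => Or.inr (Or.inl h)) ?_ ?_ ⟨hf.1.comp (by fun_prop), fun p hp => ?_⟩
  · rintro _ ⟨φ, hφ, rfl⟩
    exact ⟨_, H.neg₁ φ hφ, rfl⟩
  · rintro _ ⟨φ, hφ, rfl⟩ _ ⟨φ', hφ', rfl⟩ hne
    by_cases hex : ∃ z, φ z = φ' z
    · -- two affine functions with different slopes cross only once
      obtain ⟨z, hz⟩ := hex
      refine ⟨_, sub_mem_triangleForms (H.cross₁ φ hφ φ' hφ' hne z hz), fun p _ t _ heq => ?_⟩
      obtain ⟨m, -, c, -, h⟩ := H.affine₁ φ hφ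
      obtain ⟨m', -, c', -, h'⟩ := H.affine₁ φ' hφ'
      simp only [h, h'] at hz heq hne ⊢
      have hm : m - m' ≠ 0 := fun h0 => hne (by linarith)
      have : z = (diag p t).2 := by
        apply mul_left_cancel₀ hm
        linear_combination hz - heq
      rw [this]
    · exact ⟨_, sub_mem_triangleForms hφ, fun p _ t _ heq => absurd ⟨_, heq⟩ hex⟩
  · obtain ⟨φ, hφ, h⟩ := hf.2 p.2 ⟨hp.1.trans hp.2.1, hp.2.2⟩
    exact ⟨_, ⟨φ, hφ, rfl⟩, h⟩

lemma tame_fst (H : IsClosedFamily K Φ Ψ₀) (hf : IsSelection Φ (Icc 0 1) f) :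
    Tame Φ Ψ₀ (fun p => f p.1) := by
  refine tame_of_isSelection H (Ψ := (fun φ (p : ℝ × ℝ) => φ p.1) '' Φ)
    (fun ψ h => Or.inr (Or.inr h)) ?_ ?_ ⟨hf.1.comp (by fun_prop), fun p hp => ?_⟩
  · rintro _ ⟨φ, hφ, rfl⟩
    exact ⟨_, H.neg₁ φ hφ, rfl⟩
  · rintro _ ⟨φ, hφ, rfl⟩ _ ⟨φ', hφ', rfl⟩ hne
    by_cases hex : ∃ z, φ z = φ' z
    · obtain ⟨z, hz⟩ := hex
      refine ⟨_, sub_mem_triangleForms (H.cross₁ φ hφ φ' hφ' hne z hz), fun p _ t _ heq => ?_⟩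
      obtain ⟨m, -, c, -, h⟩ := H.affine₁ φ hφ
      obtain ⟨m', -, c', -, h'⟩ := H.affine₁ φ' hφ'
      simp only [h, h'] at hz heq hne ⊢
      have hm : m - m' ≠ 0 := fun h0 => hne (by linarith)
      have : z = (diag p t).1 := by
        apply mul_left_cancel₀ hm
        linear_combination hz - heq
      rw [this]
    · exact ⟨_, sub_mem_triangleForms hφ, fun p _ t _ heq => absurd ⟨_, heq⟩ hex⟩
  · obtain ⟨φ, hφ, h⟩ := hf.2 p.1 ⟨hp.1, hp.2.1.trans hp.2.2⟩
    exact ⟨_, ⟨φ, hφ, rfl⟩, h⟩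

end ClosedFamily

/-! ### Regions of two clocks -/

section Regions

variable {X : Type*} {r : Set (Valuation X)} {μ ν : Valuation X}

lemma IsRegion.mem_iff (hr : IsRegion r) (hν : ν ∈ r) :
    μ ∈ r ↔ (∀ x, μ x ≤ 1) ∧ (∀ x, μ x = 0 ↔ ν x = 0) ∧ (∀ x, μ x = 1 ↔ ν x = 1) ∧
      ∀ x y, μ x < μ y ↔ ν x < ν y := by
  obtain ⟨κ, -, rfl⟩ := hr
  obtain ⟨-, h1, h2, h3⟩ := hν
  simp only [mem_ofPred_eq, h1, h2, h3]

lemma IsRegion.nonempty (hr : IsRegion r) : r.Nonempty := by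
  obtain ⟨κ, hκ, rfl⟩ := hr
  exact ⟨κ, hκ, fun _ => Iff.rfl, fun _ => Iff.rfl, fun _ _ => Iff.rfl⟩

lemma IsRegion.le_one (hr : IsRegion r) (hν : ν ∈ r) (x : X) : ν x ≤ 1 :=
  ((hr.mem_iff hν).1 hν).1 x

lemma IsRegion.eq_zero_iff (hr : IsRegion r) (hν : ν ∈ r) (hμ : μ ∈ r) (x : X) :
    μ x = 0 ↔ ν x = 0 :=
  ((hr.mem_iff hν).1 hμ).2.1 x

lemma IsRegion.eq_one_iff (hr : IsRegion r) (hν : ν ∈ r) (hμ : μ ∈ r) (x : X) :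
    μ x = 1 ↔ ν x = 1 :=
  ((hr.mem_iff hν).1 hμ).2.2.1 x

lemma IsRegion.lt_iff (hr : IsRegion r) (hν : ν ∈ r) (hμ : μ ∈ r) (x y : X) :
    μ x < μ y ↔ ν x < ν y :=
  ((hr.mem_iff hν).1 hμ).2.2.2 x y

lemma IsRegion.convex (hr : IsRegion r) : Convex ℝ≥0 r := by
  intro μ hμ ν hν a b _ _ hab
  rw [hr.mem_iff hμ]
  have hab' : (a : ℝ) + b = 1 := by exact_mod_cast hab
  have ha0 : (0 : ℝ) ≤ a := a.2
  have hb0 : (0 : ℝ) ≤ b := b.2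
  have hμ1 : ∀ x, (μ x : ℝ) ≤ 1 := fun x => by exact_mod_cast hr.le_one hμ x
  have hν1 : ∀ x, (ν x : ℝ) ≤ 1 := fun x => by exact_mod_cast hr.le_one hν x
  rcases eq_or_lt_of_le ha0 with h0 | ha
  · have h1 : a = 0 := by exact_mod_cast h0.symm
    have h2 : b = 1 := by rw [h1, zero_add] at hab; exact hab
    rw [h1, h2, zero_smul, one_smul, zero_add]
    exact (hr.mem_iff hμ).1 hν
  have hcoe : ∀ x, (((a • μ + b • ν) x : ℝ≥0) : ℝ) = a * μ x + b * ν x := fun x => by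
    simp
  refine ⟨fun x => ?_, fun x => ?_, fun x => ?_, fun x y => ?_⟩
  · rw [← NNReal.coe_le_coe, hcoe]
    push_cast
    nlinarith [hμ1 x, hν1 x]
  · have h := hr.eq_zero_iff hμ hν x
    rw [← NNReal.coe_eq_zero, ← NNReal.coe_eq_zero] at h ⊢
    rw [hcoe]
    constructor
    · intro h1
      have h2 : 0 ≤ (b : ℝ) * ν x := mul_nonneg hb0 (ν x).2
      have h3 : 0 ≤ (a : ℝ) * μ x := mul_nonneg ha0 (μ x).2
      have h4 : (a : ℝ) * μ x = 0 := by linarith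
      exact (mul_eq_zero.1 h4).resolve_left ha.ne'
    · intro h1
      rw [h.2 h1, h1]
      ring
  · have h := hr.eq_one_iff hμ hν x
    rw [← NNReal.coe_eq_one, ← NNReal.coe_eq_one] at h ⊢
    rw [hcoe]
    constructor
    · intro h1
      by_contra h2
      have h3 := mul_lt_mul_of_pos_left (lt_of_le_of_ne (hμ1 x) h2) ha
      have h4 := mul_le_mul_of_nonneg_left (hν1 x) hb0
      linarith
    · intro h1
      rw [h.2 h1, h1]
      linarith
  · have h := hr.lt_iff hμ hν x y
    rw [← NNReal.coe_lt_coe, ← NNReal.coe_lt_coe] at h ⊢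
    rw [hcoe, hcoe]
    constructor
    · intro h1
      by_contra h2
      have h3 := mul_le_mul_of_nonneg_left (not_lt.1 h2) ha0
      have h4 := mul_le_mul_of_nonneg_left (not_lt.1 fun h' => h2 (h.1 h')) hb0
      linarith
    · intro h1
      have h3 := mul_lt_mul_of_pos_left h1 ha
      have h4 := mul_le_mul_of_nonneg_left (h.2 h1).le hb0
      linarith

/-- Guards cannot separate the points of a region. -/
lemma IsRegion.sat_of_sat (hr : IsRegion r) (hμ : μ ∈ r) (hν : ν ∈ r)
    {C : Finset (Constraint X)} (h : μ.Sat C) : ν.Sat C := by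
  intro c hc
  have h := h c hc
  obtain ⟨x, k, n⟩ := c
  have e0 := hr.eq_zero_iff hμ hν x
  have e1 := hr.eq_one_iff hμ hν x
  have l1 := hr.le_one hμ x
  have l2 := hr.le_one hν x
  have p1 : (0 : ℝ≥0) ≤ μ x := zero_le
  have p2 : (0 : ℝ≥0) ≤ ν x := zero_le
  simp only at h ⊢
  rcases lt_trichotomy n 1 with hn | rfl | hn
  · obtain rfl : n = 0 := by omega
    cases k <;> simp only [Cmp.Holds, Nat.cast_zero, ge_iff_le, gt_iff_lt] at h ⊢ <;> grind
  · cases k <;> simp only [Cmp.Holds, Nat.cast_one, ge_iff_le, gt_iff_lt] at h ⊢ <;> grind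
  · have hn' : (1 : ℝ≥0) < n := by exact_mod_cast hn
    cases k <;> simp only [Cmp.Holds, ge_iff_le, gt_iff_lt] at h ⊢ <;> grind

/-- The clock `x` is integral on `r`. -/
def IntegralOn (x : X) (r : Set (Valuation X)) : Prop :=
  (∀ ν ∈ r, ν x = 0) ∨ ∀ ν ∈ r, ν x = 1

/-- The set `r` lies in the open triangle `0 < x < y < 1` or on its side `x = y`. -/
def OpenOn (x y : X) (r : Set (Valuation X)) : Prop :=
  ∀ ν ∈ r, 0 < ν x ∧ ν x ≤ ν y ∧ ν y < 1

lemma IsRegion.integralOn_or_openOn (hr : IsRegion r) (x y : X) :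
    IntegralOn x r ∨ IntegralOn y r ∨ OpenOn x y r ∨ OpenOn y x r := by
  obtain ⟨μ, hμ⟩ := hr.nonempty
  by_cases hx0 : μ x = 0
  · exact Or.inl (Or.inl fun ν hν => (hr.eq_zero_iff hμ hν x).2 hx0)
  by_cases hx1 : μ x = 1
  · exact Or.inl (Or.inr fun ν hν => (hr.eq_one_iff hμ hν x).2 hx1)
  by_cases hy0 : μ y = 0
  · exact Or.inr (Or.inl (Or.inl fun ν hν => (hr.eq_zero_iff hμ hν y).2 hy0))
  by_cases hy1 : μ y = 1
  · exact Or.inr (Or.inl (Or.inr fun ν hν => (hr.eq_one_iff hμ hν y).2 hy1))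
  have hpos : ∀ z, μ z ≠ 0 → ∀ ν ∈ r, 0 < ν z := fun z hz ν hν =>
    pos_iff_ne_zero.2 fun h => hz ((hr.eq_zero_iff hμ hν z).1 h)
  have hlt : ∀ z, μ z ≠ 1 → ∀ ν ∈ r, ν z < 1 := fun z hz ν hν =>
    lt_of_le_of_ne (hr.le_one hν z) fun h => hz ((hr.eq_one_iff hμ hν z).1 h)
  rcases le_or_gt (μ x) (μ y) with h | h
  · refine Or.inr (Or.inr (Or.inl fun ν hν => ⟨hpos x hx0 ν hν, ?_, hlt y hy1 ν hν⟩))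
    exact not_lt.1 fun h' => not_lt.2 h ((hr.lt_iff hμ hν y x).1 h')
  · exact Or.inr (Or.inr (Or.inr fun ν hν =>
      ⟨hpos y hy0 ν hν, ((hr.lt_iff hμ hν y x).2 h).le, hlt x hx1 ν hν⟩))

/-- If a region with an integral clock can be reached from one point of a region, then it can be
reached from every point, by exactly one delay. -/
lemma IsRegion.exists_unique_delay {L : Set (Valuation X)} (hL : IsRegion L) (hr : IsRegion r)
    {ν₀ : Valuation X} {d₀ : ℝ≥0} (hν₀ : ν₀ ∈ L) (h₀ : ν₀.delay d₀ ∈ r) {x : X}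
    (hx : IntegralOn x r) (hν : ν ∈ L) :
    ∃ d, ν.delay d ∈ r ∧ ∀ d', ν.delay d' ∈ r → d' = d := by
  rcases hx with hx | hx
  · have hd : ∀ (κ : Valuation X) d, κ.delay d ∈ r → d = 0 := fun κ d h => by
      have := hx _ h
      simp only [Valuation.delay, add_eq_zero] at this
      exact this.2
    have hz : ∀ κ : Valuation X, κ.delay 0 = κ := fun κ => by
      funext w
      simp [Valuation.delay]
    refine ⟨0, ?_, fun d' h => hd ν d' h⟩
    obtain rfl := hd _ _ h₀
    rw [hz] at h₀ ⊢
    rw [hr.mem_iff h₀, ← hL.mem_iff hν₀]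
    exact hν
  · have h₀x : ν₀ x + d₀ = 1 := hx _ h₀
    have hle : ν x ≤ 1 := hL.le_one hν x
    obtain ⟨e, hsum⟩ : ∃ e, ν x + e = 1 := ⟨1 - ν x, add_tsub_cancel_of_le hle⟩
    refine ⟨e, ?_, fun d' h => ?_⟩
    · rw [hr.mem_iff h₀]
      simp only [Valuation.delay, add_lt_add_iff_right]
      have hle0 : ∀ w, ν₀ w ≤ ν₀ x := fun w => by
        have := hr.le_one h₀ w
        simp only [Valuation.delay] at this
        rw [← h₀x] at this
        exact le_of_add_le_add_right this
      have hle' : ∀ w, ν w ≤ ν x := fun w =>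
        not_lt.1 fun h => not_lt.2 (hle0 w) ((hL.lt_iff hν₀ hν x w).1 h)
      have hx1 := hL.eq_one_iff hν₀ hν x
      refine ⟨fun w => ?_, fun w => ?_, fun w => ?_, hL.lt_iff hν₀ hν⟩
      · rw [← hsum]
        gcongr
        exact hle' w
      · have hd : ∀ {a b : ℝ≥0}, a + b = 1 → (b = 0 ↔ a = 1) := by
          intro a b hab
          constructor
          · rintro rfl
            simpa using hab
          · rintro rfl
            simpa using hab
        rw [add_eq_zero, add_eq_zero, hd h₀x, hd hsum, hx1, hL.eq_zero_iff hν₀ hν w]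
      · have h1 : ν w + e = 1 ↔ ¬ ν w < ν x := by
          rw [← hsum, add_right_cancel_iff]
          exact ⟨fun h => h.ge.not_gt, fun h => le_antisymm (hle' w) (not_lt.1 h)⟩
        have h2 : ν₀ w + d₀ = 1 ↔ ¬ ν₀ w < ν₀ x := by
          rw [← h₀x, add_right_cancel_iff]
          exact ⟨fun h => h.ge.not_gt, fun h => le_antisymm (hle0 w) (not_lt.1 h)⟩
        rw [h1, h2, hL.lt_iff hν₀ hν]
    · have : ν x + d' = 1 := hx _ h
      exact add_left_cancel (this.trans hsum.symm)

section TwoClocks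

variable [Fintype X]

lemma eq_or_eq_of_card (hX : Fintype.card X = 2) {x y : X} (hxy : x ≠ y) (w : X) :
    w = x ∨ w = y := by
  classical
  have h : ({x, y} : Finset X) = Finset.univ :=
    Finset.eq_univ_of_card _ (by rw [Finset.card_pair hxy, hX])
  have hw := Finset.mem_univ w
  rw [← h] at hw
  simpa using hw

lemma IsRegion.mem_of_pair (hX : Fintype.card X = 2) {x y : X} (hxy : x ≠ y) (hr : IsRegion r)
    (hν : ν ∈ r) (h1 : μ x ≤ 1) (h2 : μ y ≤ 1) (h3 : μ x = 0 ↔ ν x = 0) (h4 : μ y = 0 ↔ ν y = 0)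
    (h5 : μ x = 1 ↔ ν x = 1) (h6 : μ y = 1 ↔ ν y = 1) (h7 : μ x < μ y ↔ ν x < ν y)
    (h8 : μ y < μ x ↔ ν y < ν x) : μ ∈ r := by
  rw [hr.mem_iff hν]
  have h := eq_or_eq_of_card hX hxy
  refine ⟨fun w => ?_, fun w => ?_, fun w => ?_, fun w w' => ?_⟩
  · rcases h w with rfl | rfl <;> assumption
  · rcases h w with rfl | rfl <;> assumption
  · rcases h w with rfl | rfl <;> assumption
  · rcases h w with rfl | rfl <;> rcases h w' with rfl | rfl <;> first | assumption | simp

/-- The delays into an open region are determined by the bounds `0` and `1`. -/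
lemma IsRegion.delay_mem_iff (hX : Fintype.card X = 2) {x y : X} (hxy : x ≠ y)
    {L : Set (Valuation X)} (hL : IsRegion L) (hr : IsRegion r) {ν₀ : Valuation X} {d₀ : ℝ≥0}
    (hν₀ : ν₀ ∈ L) (h₀ : ν₀.delay d₀ ∈ r) (hxyr : OpenOn x y r) (hν : ν ∈ L) :
    ν x ≤ ν y ∧ ν y < 1 ∧ ∀ d, ν.delay d ∈ r ↔ 0 < ν x + d ∧ ν y + d < 1 := by
  obtain ⟨h1, h2, h3⟩ := hxyr _ h₀
  simp only [Valuation.delay] at h1 h2 h3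
  have h2' : ν₀ x ≤ ν₀ y := le_of_add_le_add_right h2
  have hle : ν x ≤ ν y := not_lt.1 fun h => not_lt.2 h2' ((hL.lt_iff hν₀ hν y x).1 h)
  have hlt1 : ν₀ y < 1 := lt_of_le_of_lt le_self_add h3
  have hlt : ν y < 1 := lt_of_le_of_ne (hL.le_one hν y) fun h =>
    hlt1.ne ((hL.eq_one_iff hν₀ hν y).1 h)
  refine ⟨hle, hlt, fun d => ⟨fun h => ?_, fun h => ?_⟩⟩
  · obtain ⟨h1, -, h3⟩ := hxyr _ h
    exact ⟨h1, h3⟩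
  · have g1 : ν x + d ≤ ν y + d := by gcongr
    have g2 : ν₀ x + d₀ ≤ ν₀ y + d₀ := h2
    have iff_of_not : ∀ {p q : Prop}, ¬p → ¬q → (p ↔ q) := fun hp hq =>
      ⟨fun h => absurd h hp, fun h => absurd h hq⟩
    refine hr.mem_of_pair hX hxy h₀ (g1.trans h.2.le) h.2.le (iff_of_not h.1.ne' h1.ne')
      (iff_of_not (h.1.trans_le g1).ne' (h1.trans_le g2).ne')
      (iff_of_not (g1.trans_lt h.2).ne (g2.trans_lt h3).ne) (iff_of_not h.2.ne h3.ne) ?_ ?_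
    · simp only [Valuation.delay, add_lt_add_iff_right]
      exact hL.lt_iff hν₀ hν x y
    · simp only [Valuation.delay, add_lt_add_iff_right]
      exact hL.lt_iff hν₀ hν y x

end TwoClocks

end Regions

/-! ### One step of value iteration on regions -/

/-- `F` is on `r` a function of the form that value iteration produces: a continuous selection of
`Φ`, applied to the clock `y`, if the clock `x` is integral, and a function from the class `𝓒`,
applied to the pair of the clocks, if `r` is open. On the regions where more than one of these
descriptions of `r` apply, all of them are available. -/
def IsRepresented {X : Type*} (Φ : Set (ℝ → ℝ)) (𝓒 : (ℝ × ℝ → ℝ) → Prop) (r : Set (Valuation X))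
    (F : Valuation X → ℝ) : Prop :=
  (∀ x y, x ≠ y → IntegralOn x r →
    ∃ f, IsSelection Φ (Icc 0 1) f ∧ ∀ ν ∈ r, F ν = f (ν y)) ∧
  ∀ x y, x ≠ y → OpenOn x y r → ∃ g, 𝓒 g ∧ ∀ ν ∈ r, F ν = g (ν x, ν y)

section Represented

variable {X : Type*} {K : Subfield ℝ} {Φ : Set (ℝ → ℝ)} {Ψ₀ : Set (ℝ × ℝ → ℝ)}
  {𝓒 𝓒' : (ℝ × ℝ → ℝ) → Prop} {r L : Set (Valuation X)} {F G : Valuation X → ℝ}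

lemma IsRepresented.mono (h : ∀ g, 𝓒 g → 𝓒' g) (hF : IsRepresented Φ 𝓒 r F) :
    IsRepresented Φ 𝓒' r F :=
  ⟨hF.1, fun x y hxy hr => (hF.2 x y hxy hr).imp fun g hg => ⟨h g hg.1, hg.2⟩⟩

lemma IsRepresented.neg (H : IsClosedFamily K Φ Ψ₀) (h : ∀ g, 𝓒 g → 𝓒' (fun p => -g p))
    (hF : IsRepresented Φ 𝓒 r F) : IsRepresented Φ 𝓒' r (fun ν => -F ν) := by
  refine ⟨fun x y hxy hr => ?_, fun x y hxy hr => ?_⟩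
  · obtain ⟨f, hf, h'⟩ := hF.1 x y hxy hr
    exact ⟨_, hf.neg H.neg₁, fun ν hν => by simp only [h' ν hν]⟩
  · obtain ⟨g, hg, h'⟩ := hF.2 x y hxy hr
    exact ⟨_, h g hg, fun ν hν => by simp only [h' ν hν]⟩

lemma IsRepresented.min (h : ∀ g g', 𝓒 g → 𝓒 g' → 𝓒 (fun p => g p ⊓ g' p))
    (hF : IsRepresented Φ 𝓒 r F) (hG : IsRepresented Φ 𝓒 r G) :
    IsRepresented Φ 𝓒 r (fun ν => F ν ⊓ G ν) := by
  refine ⟨fun x y hxy hr => ?_, fun x y hxy hr => ?_⟩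
  · obtain ⟨f, hf, h'⟩ := hF.1 x y hxy hr
    obtain ⟨f', hf', h''⟩ := hG.1 x y hxy hr
    exact ⟨_, hf.min hf', fun ν hν => by simp only [h' ν hν, h'' ν hν]⟩
  · obtain ⟨g, hg, h'⟩ := hF.2 x y hxy hr
    obtain ⟨g', hg', h''⟩ := hG.2 x y hxy hr
    exact ⟨_, h g g' hg hg', fun ν hν => by simp only [h' ν hν, h'' ν hν]⟩

lemma coe_le_one_of_mem (hr : IsRegion r) {ν : Valuation X} (hν : ν ∈ r) (x : X) :
    (ν x : ℝ) ≤ 1 := by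
  exact_mod_cast hr.le_one hν x

lemma IntegralOn.exists_eq {x : X} (h : IntegralOn x r) :
    ∃ n : ℝ, (n = 0 ∨ n = 1) ∧ ∀ ν ∈ r, (ν x : ℝ) = n := by
  rcases h with h | h
  · exact ⟨0, Or.inl rfl, fun ν hν => by rw [h ν hν]; rfl⟩
  · exact ⟨1, Or.inr rfl, fun ν hν => by rw [h ν hν]; rfl⟩

lemma OpenOn.coe {x y : X} (h : OpenOn x y r) {ν : Valuation X} (hν : ν ∈ r) :
    0 < (ν x : ℝ) ∧ (ν x : ℝ) ≤ ν y ∧ (ν y : ℝ) < 1 := by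
  exact_mod_cast h ν hν

variable [Fintype X]

/-- Taking a reset turns a function on the target region into a function on the region before the
reset: a reset clock is replaced by `0`, and the target function depends only on the other one. -/
lemma IsRepresented.comp_reset (hX : Fintype.card X = 2) (H : IsClosedFamily K Φ Ψ₀) {Y : Set X}
    (hr : (fun ν => ν.reset Y) '' r = L) (hF : IsRepresented Φ (Tame Φ Ψ₀) L F) :
    IsRepresented Φ (Tame Φ Ψ₀) r (fun ν => F (ν.reset Y)) := by
  classical
  subst hr
  have hin : ∀ {ν : Valuation X} {x}, x ∈ Y → ν.reset Y x = 0 := fun h => by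
    simp [Valuation.reset, h]
  have hout : ∀ {ν : Valuation X} {x}, x ∉ Y → ν.reset Y x = ν x := fun h => by
    simp [Valuation.reset, h]
  have hint : ∀ {x}, x ∈ Y → IntegralOn x ((fun ν => ν.reset Y) '' r) := fun h =>
    Or.inl (by rintro _ ⟨ν, -, rfl⟩; exact hin h)
  -- the case in which the target function depends on the clock `y` only
  have key : ∀ {x y}, x ≠ y → IntegralOn x ((fun ν => ν.reset Y) '' r) →
      ∃ f, IsSelection Φ (Icc 0 1) f ∧ ∀ ν ∈ r, F (ν.reset Y) = f (ν y) := by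
    intro x y hxy hx
    obtain ⟨f, hf, h⟩ := hF.1 x y hxy hx
    by_cases hy : y ∈ Y
    · refine ⟨_, isSelection_const_zero H hf, fun ν hν => ?_⟩
      rw [h _ ⟨ν, hν, rfl⟩]
      simp only [hin hy, NNReal.coe_zero]
    · exact ⟨f, hf, fun ν hν => by rw [h _ ⟨ν, hν, rfl⟩]; simp only [hout hy]⟩
  refine ⟨fun x y hxy hx => key hxy ?_, fun x y hxy ho => ?_⟩
  · by_cases hxY : x ∈ Y
    · exact hint hxY
    · refine hx.imp (fun h => ?_) (fun h => ?_) <;>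
        (rintro _ ⟨ν, hν, rfl⟩; simpa only [hout hxY] using h ν hν)
  · by_cases hxY : x ∈ Y
    · obtain ⟨f, hf, h⟩ := key hxy (hint hxY)
      exact ⟨_, tame_snd H hf, h⟩
    · by_cases hyY : y ∈ Y
      · obtain ⟨f, hf, h⟩ := key hxy.symm (hint hyY)
        exact ⟨_, tame_fst H hf, h⟩
      · have hid : ∀ ν : Valuation X, ν.reset Y = ν := fun ν => by
          funext w
          rcases eq_or_eq_of_card hX hxy w with rfl | rfl
          exacts [hout hxY, hout hyY]
        simp only [hid, image_id'] at hF ⊢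
        exact hF.2 x y hxy ho

/-- `F ν` is on `L` the infimum of `G` over the delays from `ν` into `r`. -/
def IsDelayInf (L r : Set (Valuation X)) (G F : Valuation X → ℝ) : Prop :=
  ∀ ν ∈ L, (∀ d, ν.delay d ∈ r → F ν ≤ G (ν.delay d)) ∧
    ∀ c : EReal, (∀ d, ν.delay d ∈ r → c ≤ (G (ν.delay d) : EReal)) → c ≤ (F ν : EReal)

lemma exists_isDelayInf_of_integralOn (hX : Fintype.card X = 2) (H : IsClosedFamily K Φ Ψ₀)
    (hL : IsRegion L) (hr : IsRegion r) {ν₀ : Valuation X} {d₀ : ℝ≥0} (hν₀ : ν₀ ∈ L)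
    (h₀ : ν₀.delay d₀ ∈ r) (hG : IsRepresented Φ (Tame Φ Ψ₀) r G) {x y : X} (hxy : x ≠ y)
    (hx : IntegralOn x r) :
    ∃ F, IsRepresented Φ (Rising Φ Ψ₀) L F ∧ IsDelayInf L r G F := by
  obtain ⟨f, hf, hGf⟩ := hG.1 x y hxy hx
  have hdel : ∀ ν ∈ L, ∃ d, ν.delay d ∈ r := fun ν hν =>
    (hL.exists_unique_delay hr hν₀ h₀ hx hν).imp fun d hd => hd.1
  obtain ⟨n, hn, hxn⟩ := hx.exists_eq
  have hx' : ∀ {ν : Valuation X} {d}, ν.delay d ∈ r → (ν x : ℝ) + d = n := fun h => by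
    rw [← hxn _ h]
    simp [Valuation.delay]
  have hy' : ∀ {ν : Valuation X} {d}, ν.delay d ∈ r →
      ((ν.delay d y : ℝ≥0) : ℝ) = ν y + n - ν x := fun h => by
    rw [← hx' h]
    simp only [Valuation.delay, NNReal.coe_add]
    ring
  have hbd : ∀ ν ∈ L, 0 ≤ (ν x : ℝ) ∧ 0 ≤ (ν y : ℝ) ∧ (ν x : ℝ) ≤ n ∧
      (ν y : ℝ) + n - ν x ≤ 1 := by
    intro ν hν
    obtain ⟨d, hd⟩ := hdel ν hν
    refine ⟨(ν x).2, (ν y).2, ?_, ?_⟩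
    · rw [← hx' hd]
      linarith [show (0 : ℝ) ≤ d from d.2]
    · rw [← hy' hd]
      exact coe_le_one_of_mem hr hd y
  refine ⟨fun ν => f (ν y + n - ν x), ⟨fun u v huv hu => ?_, fun u v huv ho => ?_⟩,
    fun ν hν => ⟨fun d hd => ?_, fun c hc => ?_⟩⟩
  · obtain ⟨m, hm, hum⟩ := hu.exists_eq
    have hmn : (∀ ν ∈ L, (ν y : ℝ) + n - ν x = ν v) ∨ (∀ ν ∈ L, (ν y : ℝ) + n - ν x = 1 - ν v) ∨
        (∀ ν ∈ L, (ν y : ℝ) + n - ν x = 0) ∨ ∀ ν ∈ L, (ν y : ℝ) + n - ν x = 1 := by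
      rcases eq_or_eq_of_card hX hxy u with rfl | rfl
      · obtain rfl : v = y := (eq_or_eq_of_card hX hxy v).resolve_left (Ne.symm huv)
        rcases hn with rfl | rfl
        · refine Or.inl fun ν hν => ?_
          linarith [hbd ν hν]
        · rcases hm with rfl | rfl
          · refine Or.inr (Or.inr (Or.inr fun ν hν => ?_))
            linarith [hbd ν hν, hum ν hν]
          · refine Or.inl fun ν hν => ?_
            linarith [hbd ν hν, hum ν hν]
      · obtain rfl : v = x := (eq_or_eq_of_card hX hxy v).resolve_right (Ne.symm huv)
        rcases hn with rfl | rfl <;> rcases hm with rfl | rfl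
        · refine Or.inr (Or.inr (Or.inl fun ν hν => ?_))
          linarith [hbd ν hν, hum ν hν]
        · refine Or.inr (Or.inr (Or.inr fun ν hν => ?_))
          linarith [hbd ν hν, hum ν hν]
        · refine Or.inr (Or.inl fun ν hν => ?_)
          linarith [hbd ν hν, hum ν hν]
        · refine Or.inr (Or.inr (Or.inr fun ν hν => ?_))
          linarith [hbd ν hν, hum ν hν, coe_le_one_of_mem hL hν v]
    rcases hmn with h | h | h | h
    · exact ⟨f, hf, fun ν hν => by simp only [h ν hν]⟩
    · exact ⟨_, isSelection_refl H hf, fun ν hν => by simp only [h ν hν]⟩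
    · exact ⟨_, isSelection_const_zero H hf, fun ν hν => by simp only [h ν hν]⟩
    · exact ⟨_, isSelection_const_one H hf, fun ν hν => by simp only [h ν hν]⟩
  · rcases eq_or_eq_of_card hX hxy u with rfl | rfl
    · obtain rfl : v = y := (eq_or_eq_of_card hX hxy v).resolve_left (Ne.symm huv)
      refine ⟨_, rising_sub (isSelection_const_one H hf), fun ν hν => ?_⟩
      have h1 := hbd ν hν
      have h2 := ho.coe hν
      rcases hn with rfl | rfl
      · linarith
      · exact congrArg f (by linarith)
    · obtain rfl : v = x := (eq_or_eq_of_card hX hxy v).resolve_right (Ne.symm huv)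
      refine ⟨_, rising_sub (isSelection_refl H hf), fun ν hν => ?_⟩
      have h1 := hbd ν hν
      have h2 := ho.coe hν
      rcases hn with rfl | rfl
      · linarith
      · exact congrArg f (by simp only; ring)
  · rw [hGf _ hd, hy' hd]
  · obtain ⟨d, hd⟩ := hdel ν hν
    have := hc d hd
    rwa [hGf _ hd, hy' hd] at this

lemma exists_isDelayInf_of_openOn (hX : Fintype.card X = 2) (H : IsClosedFamily K Φ Ψ₀)
    (hL : IsRegion L) (hr : IsRegion r) {ν₀ : Valuation X} {d₀ : ℝ≥0} (hν₀ : ν₀ ∈ L)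
    (h₀ : ν₀.delay d₀ ∈ r) (hG : IsRepresented Φ (Tame Φ Ψ₀) r G) {x y : X} (hxy : x ≠ y)
    (ho : OpenOn x y r) :
    ∃ F, IsRepresented Φ (Rising Φ Ψ₀) L F ∧ IsDelayInf L r G F := by
  obtain ⟨g, hg, hGg⟩ := hG.2 x y hxy ho
  have hfut := hg.rising_futureInf
  have hdel : ∀ ν ∈ L, (ν x : ℝ) ≤ ν y ∧ (ν y : ℝ) < 1 ∧
      ∀ d : ℝ≥0, ν.delay d ∈ r ↔ 0 < (ν x : ℝ) + d ∧ (ν y : ℝ) + d < 1 := by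
    intro ν hν
    exact_mod_cast hL.delay_mem_iff hX hxy hr hν₀ h₀ ho hν
  have hdiag : ∀ (ν : Valuation X) (d : ℝ≥0) (t : ℝ), (d : ℝ) = t * (1 - ν y) →
      (((ν.delay d x : ℝ≥0) : ℝ), ((ν.delay d y : ℝ≥0) : ℝ)) = diag ((ν x : ℝ), (ν y : ℝ)) t := by
    intro ν d t h
    simp only [Valuation.delay, NNReal.coe_add, diag, h]
  refine ⟨fun ν => futureInf g (ν x, ν y), ⟨fun u v huv hu => ?_, fun u v huv ho' => ?_⟩,
    fun ν hν => ⟨fun d hd => ?_, fun c hc => ?_⟩⟩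
  · obtain ⟨m, hm, hum⟩ := hu.exists_eq
    have hstart := isSelection_start H hfut.1
    have hm0 : ∀ ν ∈ L, (ν u : ℝ) = 0 := by
      intro ν hν
      rcases hm with rfl | rfl
      · exact hum ν hν
      · have h1 := hdel ν hν
        have h2 := hum ν hν
        rcases eq_or_eq_of_card hX hxy u with rfl | rfl <;> linarith
    rcases eq_or_eq_of_card hX hxy u with rfl | rfl
    · obtain rfl : v = y := (eq_or_eq_of_card hX hxy v).resolve_left (Ne.symm huv)
      exact ⟨_, hstart, fun ν hν => by simp only [hm0 ν hν]⟩
    · refine ⟨_, isSelection_const_zero H hstart, fun ν hν => ?_⟩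
      have h1 := hm0 ν hν
      have h2 : (ν x : ℝ) = 0 := le_antisymm (h1 ▸ (hdel ν hν).1) (ν x).2
      simp only [h1, h2]
  · rcases eq_or_eq_of_card hX hxy u with rfl | rfl
    · obtain rfl : v = y := (eq_or_eq_of_card hX hxy v).resolve_left (Ne.symm huv)
      exact ⟨_, hfut, fun ν hν => rfl⟩
    · obtain rfl : v = x := (eq_or_eq_of_card hX hxy v).resolve_right (Ne.symm huv)
      refine ⟨_, hfut, fun ν hν => ?_⟩
      have h : (ν v : ℝ) = ν u := le_antisymm (hdel ν hν).1 (ho'.coe hν).2.1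
      simp only [h]
  · obtain ⟨-, h1, h2⟩ := hdel ν hν
    have h3 := ((h2 d).1 hd).2
    have h4 : 0 < 1 - (ν y : ℝ) := sub_pos.2 h1
    rw [hGg _ hd, hdiag ν d (d / (1 - ν y)) (by field_simp)]
    refine futureInf_le hg.1.1 _ ⟨div_nonneg d.2 h4.le, (div_le_one h4).2 (by linarith)⟩
  · obtain ⟨-, h1, h2⟩ := hdel ν hν
    have h4 : 0 < 1 - (ν y : ℝ) := sub_pos.2 h1
    obtain ⟨t, ht, heq, -⟩ := exists_futureInf_eq hg.1.1 ((ν x : ℝ), (ν y : ℝ))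
    -- the bound extends by continuity from the delays that are possible to the boundary delays
    have hcl : IsClosed {t : ℝ | c ≤ (g (diag ((ν x : ℝ), (ν y : ℝ)) t) : EReal)} :=
      isClosed_le continuous_const
        (continuous_coe_real_ereal.comp (continuous_along_diag hg.1.1 _))
    have hsub : Ioo (0 : ℝ) 1 ⊆ {t : ℝ | c ≤ (g (diag ((ν x : ℝ), (ν y : ℝ)) t) : EReal)} := by
      intro s hs
      have hs0 : 0 < s * (1 - ν y) := mul_pos hs.1 h4
      have hd : (((s * (1 - ν y)).toNNReal : ℝ≥0) : ℝ) = s * (1 - ν y) :=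
        Real.coe_toNNReal _ hs0.le
      have hmem : ν.delay (s * (1 - ν y)).toNNReal ∈ r := by
        rw [h2, hd]
        have := mul_lt_mul_of_pos_right hs.2 h4
        exact ⟨by linarith [show (0 : ℝ) ≤ ν x from (ν x).2], by linarith⟩
      have := hc _ hmem
      rwa [hGg _ hmem, hdiag ν _ s hd] at this
    have := closure_minimal hsub hcl
    rw [closure_Ioo zero_ne_one] at this
    simp only [heq]
    exact this ht

/-- The infimum over the delays into a region. -/
lemma exists_isDelayInf (hX : Fintype.card X = 2) (H : IsClosedFamily K Φ Ψ₀)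
    (hL : IsRegion L) (hr : IsRegion r) {ν₀ : Valuation X} {d₀ : ℝ≥0} (hν₀ : ν₀ ∈ L)
    (h₀ : ν₀.delay d₀ ∈ r) (hG : IsRepresented Φ (Tame Φ Ψ₀) r G) :
    ∃ F, IsRepresented Φ (Rising Φ Ψ₀) L F ∧ IsDelayInf L r G F := by
  obtain ⟨x, y, hxy⟩ := Fintype.exists_pair_of_one_lt_card (α := X) (by omega)
  rcases hr.integralOn_or_openOn x y with h | h | h | h
  · exact exists_isDelayInf_of_integralOn hX H hL hr hν₀ h₀ hG hxy h
  · exact exists_isDelayInf_of_integralOn hX H hL hr hν₀ h₀ hG hxy.symm h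
  · exact exists_isDelayInf_of_openOn hX H hL hr hν₀ h₀ hG hxy h
  · exact exists_isDelayInf_of_openOn hX H hL hr hν₀ h₀ hG hxy.symm h

/-! ### Represented functions and affine forms of valuations -/

/-- All represented functions are continuous selections of one finite set of affine forms. -/
lemma exists_forms_of_isRepresented (hX : Fintype.card X = 2) (H : IsClosedFamily K Φ Ψ₀) :
    ∃ Θ : Set (AffineForm X), Θ.Finite ∧ (∀ θ ∈ Θ, θ.Over K) ∧
      ∀ (L : Set (Valuation X)) (F : Valuation X → ℝ), IsRegion L →
        IsRepresented Φ (IsSelection (triangleForms Φ Ψ₀) triangle) L F →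
          IsFormSelection Θ L F := by
  classical
  have h1 : ∀ φ, IsAffine₁ K φ → ∀ y : X, ∃ θ : AffineForm X, θ.Over K ∧
      ∀ ν : Valuation X, θ.eval ν = φ (ν y) := by
    rintro φ ⟨m, hm, c, hc, h⟩ y
    refine ⟨⟨Pi.single y m, c⟩, ⟨fun x => ?_, hc⟩, fun ν => ?_⟩
    · by_cases hx : x = y
      · subst hx
        simpa using hm
      · simp [hx, zero_mem K]
    · simp [AffineForm.eval, h, Pi.single_apply]
  have h2 : ∀ ψ, IsAffine₂ K ψ → ∀ x y : X, ∃ θ : AffineForm X, θ.Over K ∧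
      ∀ ν : Valuation X, θ.eval ν = ψ (ν x, ν y) := by
    rintro ψ ⟨p, hp, q, hq, c, hc, h⟩ x y
    refine ⟨⟨Pi.single x p + Pi.single y q, c⟩, ⟨fun w => ?_, hc⟩, fun ν => ?_⟩
    · have hs : ∀ (z : X) (a : ℝ), a ∈ K → (Pi.single z a : X → ℝ) w ∈ K := by
        intro z a ha
        rw [Pi.single_apply]
        split_ifs
        exacts [ha, zero_mem K]
      exact add_mem (hs x p hp) (hs y q hq)
    · simp [AffineForm.eval, h, Pi.single_apply, add_mul, Finset.sum_add_distrib]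
  have : Nonempty (AffineForm X) := ⟨⟨0, 0⟩⟩
  choose! e₁ he₁ he₁' using h1
  choose! e₂ he₂ he₂' using h2
  refine ⟨Set.image2 e₁ Φ univ ∪ Set.image2 (fun ψ (k : X × X) => e₂ ψ k.1 k.2)
    (triangleForms Φ Ψ₀) univ, (H.finite₁.image2 _ finite_univ).union
      ((finite_triangleForms H).image2 _ finite_univ), ?_, fun L F hL hF => ?_⟩
  · rintro _ (⟨φ, hφ, y, -, rfl⟩ | ⟨ψ, hψ, k, -, rfl⟩)
    · exact he₁ _ (H.affine₁ φ hφ) y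
    · exact he₂ _ (affine_triangleForms H ψ hψ) k.1 k.2
  · have hint : ∀ x y, x ≠ y → IntegralOn x L → IsFormSelection
        (Set.image2 e₁ Φ univ ∪ Set.image2 (fun ψ (k : X × X) => e₂ ψ k.1 k.2)
          (triangleForms Φ Ψ₀) univ) L F := by
      intro x y hxy hx
      obtain ⟨f, hf, h⟩ := hF.1 x y hxy hx
      refine ⟨?_, fun ν hν => ?_⟩
      · exact ContinuousOn.congr (f := fun ν : Valuation X => f (ν y))
          (hf.1.comp (by fun_prop)).continuousOn h
      · obtain ⟨φ, hφ, h'⟩ := hf.2 (ν y) ⟨(ν y).2, coe_le_one_of_mem hL hν y⟩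
        exact ⟨_, Or.inl ⟨φ, hφ, y, mem_univ y, rfl⟩, by
          rw [h ν hν, h', he₁' _ (H.affine₁ φ hφ)]⟩
    have hopen : ∀ x y, x ≠ y → OpenOn x y L → IsFormSelection
        (Set.image2 e₁ Φ univ ∪ Set.image2 (fun ψ (k : X × X) => e₂ ψ k.1 k.2)
          (triangleForms Φ Ψ₀) univ) L F := by
      intro x y hxy ho
      obtain ⟨g, hg, h⟩ := hF.2 x y hxy ho
      refine ⟨?_, fun ν hν => ?_⟩
      · exact ContinuousOn.congr (f := fun ν : Valuation X => g (ν x, ν y))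
          (hg.1.comp (by fun_prop)).continuousOn h
      · obtain ⟨o1, o2, o3⟩ := ho.coe hν
        obtain ⟨ψ, hψ, h'⟩ := hg.2 (ν x, ν y) ⟨o1.le, o2, o3.le⟩
        exact ⟨_, Or.inr ⟨ψ, hψ, (x, y), mem_univ _, rfl⟩, by
          rw [h ν hν, h', he₂' _ (affine_triangleForms H ψ hψ)]⟩
    obtain ⟨x, y, hxy⟩ := Fintype.exists_pair_of_one_lt_card (α := X) (by omega)
    rcases hL.integralOn_or_openOn x y with h | h | h | h
    · exact hint x y hxy h
    · exact hint y x hxy.symm h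
    · exact hopen x y hxy h
    · exact hopen y x hxy.symm h

/-- The affine form `θ` as a function of the clocks `x` and `y`. -/
def AffineForm.pair (θ : AffineForm X) (x y : X) (p : ℝ × ℝ) : ℝ :=
  θ.coeff x * p.1 + θ.coeff y * p.2 + θ.const

lemma AffineForm.eval_eq_pair (hX : Fintype.card X = 2) {x y : X} (hxy : x ≠ y)
    (θ : AffineForm X) (ν : Valuation X) : θ.eval ν = θ.pair x y (ν x, ν y) := by
  classical
  have h : (Finset.univ : Finset X) = {x, y} :=
    (Finset.eq_univ_of_card _ (by rw [Finset.card_pair hxy, hX])).symm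
  simp [AffineForm.eval, AffineForm.pair, h, Finset.sum_pair hxy]

lemma IsAffine₁.lipschitz {φ : ℝ → ℝ} (h : IsAffine₁ K φ) : ∃ C : ℝ≥0, LipschitzWith C φ := by
  obtain ⟨m, -, c, -, h⟩ := h
  refine ⟨‖m‖₊, LipschitzWith.of_dist_le_mul fun a b => ?_⟩
  rw [h, h, Real.dist_eq, Real.dist_eq, show m * a + c - (m * b + c) = m * (a - b) by ring,
    abs_mul]
  rfl

lemma IsAffine₂.lipschitz {ψ : ℝ × ℝ → ℝ} (h : IsAffine₂ K ψ) :
    ∃ C : ℝ≥0, LipschitzWith C ψ := by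
  obtain ⟨p, -, q, -, c, -, h⟩ := h
  refine ⟨‖p‖₊ + ‖q‖₊, LipschitzWith.of_dist_le_mul fun a b => ?_⟩
  have h1 : |a.1 - b.1| ≤ dist a b := by rw [Prod.dist_eq]; exact le_max_left _ _
  have h2 : |a.2 - b.2| ≤ dist a b := by rw [Prod.dist_eq]; exact le_max_right _ _
  have h3 := mul_le_mul_of_nonneg_left h1 (abs_nonneg p)
  have h4 := mul_le_mul_of_nonneg_left h2 (abs_nonneg q)
  have h5 := abs_add_le (p * (a.1 - b.1)) (q * (a.2 - b.2))
  rw [abs_mul, abs_mul] at h5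
  rw [h, h, Real.dist_eq, show p * a.1 + q * a.2 + c - (p * b.1 + q * b.2 + c) =
    p * (a.1 - b.1) + q * (a.2 - b.2) by ring]
  have h6 : ((‖p‖₊ + ‖q‖₊ : ℝ≥0) : ℝ) = |p| + |q| := rfl
  rw [h6, add_mul]
  linarith

end Represented

section Outputs

variable {X : Type*} {K : Subfield ℝ} {Φ : Set (ℝ → ℝ)} {Ψ₀ : Set (ℝ × ℝ → ℝ)}
  {L : Set (Valuation X)} {F : Valuation X → ℝ}

open Classical in
/-- The valuation of two clocks that maps `x` to `p.1` and the other clock to `p.2`. -/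
noncomputable def pairValuation (x : X) (p : ℝ × ℝ) : Valuation X :=
  fun w => if w = x then p.1.toNNReal else p.2.toNNReal

lemma continuous_pairValuation (x : X) : Continuous (pairValuation x) := by
  have := continuous_real_toNNReal
  refine continuous_pi fun w => ?_
  by_cases hw : w = x <;> simp only [pairValuation, hw, if_true, if_false] <;> fun_prop

lemma pairValuation_left (x : X) (p : ℝ × ℝ) : pairValuation x p x = p.1.toNNReal := by
  simp [pairValuation]

lemma pairValuation_right {x y : X} (hxy : x ≠ y) (p : ℝ × ℝ) :
    pairValuation x p y = p.2.toNNReal := by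
  simp [pairValuation, hxy.symm]

variable [Fintype X] {Θ : Set (AffineForm X)}

lemma pairValuation_coe (hX : Fintype.card X = 2) {x y : X} (hxy : x ≠ y) (ν : Valuation X) :
    pairValuation x ((ν x : ℝ), (ν y : ℝ)) = ν := by
  funext w
  rcases eq_or_eq_of_card hX hxy w with rfl | rfl
  · simp [pairValuation_left]
  · simp [pairValuation_right hxy]

lemma eval_pairValuation (hX : Fintype.card X = 2) {x y : X} (hxy : x ≠ y) (θ : AffineForm X)
    {p : ℝ × ℝ} (h1 : 0 ≤ p.1) (h2 : 0 ≤ p.2) : θ.eval (pairValuation x p) = θ.pair x y p := by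
  rw [θ.eval_eq_pair hX hxy, pairValuation_left, pairValuation_right hxy,
    Real.coe_toNNReal _ h1, Real.coe_toNNReal _ h2]

lemma exists_extension_along_path (H : IsClosedFamily K Φ Ψ₀) (hF : IsFormSelection Θ L F)
    {γ : ℝ → Valuation X} (hγ : Continuous γ) (hγL : ∀ z ∈ Ioo (0 : ℝ) 1, γ z ∈ L)
    (hφ : ∀ θ ∈ Θ, ∃ φ ∈ Φ, ∀ z ∈ Ioo (0 : ℝ) 1, θ.eval (γ z) = φ z) :
    ∃ f, IsSelection Φ (Icc 0 1) f ∧ ∀ z ∈ Ioo (0 : ℝ) 1, F (γ z) = f z := by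
  obtain ⟨f, hf, hfe, hfs⟩ := exists_continuous_extension_of_selection (convex_Ioo (0 : ℝ) 1)
    H.finite₁ (fun φ hφ => (H.affine₁ φ hφ).lipschitz) (f := fun z => F (γ z))
    (hF.1.comp hγ.continuousOn hγL) (fun z hz => by
      obtain ⟨θ, hθ, h⟩ := hF.2 _ (hγL z hz)
      obtain ⟨φ, hφ, h'⟩ := hφ θ hθ
      exact ⟨φ, hφ, h.trans (h' z hz)⟩)
  rw [closure_Ioo zero_ne_one] at hfs
  exact ⟨f, ⟨hf, hfs⟩, hfe⟩

/-- The closed triangle lies in the closure of its interior. -/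
lemma triangle_subset_closure :
    triangle ⊆ closure {p : ℝ × ℝ | 0 < p.1 ∧ p.1 < p.2 ∧ p.2 < 1} := by
  intro p hp
  have hpath : Continuous fun t : ℝ =>
      ((1 - t) * p.1 + t * (1 / 3), (1 - t) * p.2 + t * (2 / 3)) := by fun_prop
  have h1 := hpath.continuousWithinAt (s := Ioo 0 1) (x := 0)
  have h2 : (0 : ℝ) ∈ closure (Ioo (0 : ℝ) 1) := by
    rw [closure_Ioo zero_ne_one]
    exact ⟨le_rfl, zero_le_one⟩
  have h3 := h1.mem_closure h2 (t := {p : ℝ × ℝ | 0 < p.1 ∧ p.1 < p.2 ∧ p.2 < 1}) (by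
    intro t ht
    have ht' := sub_pos.2 ht.2
    have ht0 := ht.1
    have g1 := mul_nonneg ht'.le hp.1
    have g2 := mul_le_mul_of_nonneg_left hp.2.1 ht'.le
    have g3 := mul_le_mul_of_nonneg_left hp.2.2 ht'.le
    refine ⟨?_, ?_, ?_⟩ <;> simp only <;> linarith)
  simpa using h3

lemma convex_open_triangle : Convex ℝ {p : ℝ × ℝ | 0 < p.1 ∧ p.1 < p.2 ∧ p.2 < 1} := by
  rintro ⟨a, b⟩ ⟨h1, h2, h3⟩ ⟨a', b'⟩ ⟨h1', h2', h3'⟩ s t hs ht hst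
  simp only at h1 h2 h3 h1' h2' h3'
  simp only [mem_ofPred_eq, Prod.smul_mk, smul_eq_mul, Prod.mk_add_mk]
  have k : ∀ {u v : ℝ}, 0 < u → 0 < v → 0 < s * u + t * v := by
    intro u v hu hv
    rcases hs.eq_or_lt with rfl | hs
    · have : t = 1 := by linarith
      simpa [this] using hv
    · have := mul_pos hs hu
      have := mul_nonneg ht hv.le
      linarith
  have e1 := k h1 h1'
  have e2 := k (sub_pos.2 h2) (sub_pos.2 h2')
  have e3 := k (sub_pos.2 h3) (sub_pos.2 h3')
  refine ⟨e1, by linarith, by linarith⟩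

/-- An output function has the form that value iteration produces, for families that contain its
affine pieces and their restrictions to the sides of the triangle. -/
lemma IsFormSelection.isRepresented (hX : Fintype.card X = 2) (H : IsClosedFamily K Φ Ψ₀)
    (hL : IsRegion L) (hF : IsFormSelection Θ L F)
    (hΨ : ∀ θ ∈ Θ, ∀ x y, θ.pair x y ∈ Ψ₀)
    (h0 : ∀ θ ∈ Θ, ∀ x y, (fun z => θ.pair x y (0, z)) ∈ Φ)
    (h1 : ∀ θ ∈ Θ, ∀ x y, (fun z => θ.pair x y (1, z)) ∈ Φ)
    (hd : ∀ θ ∈ Θ, ∀ x y, (fun z => θ.pair x y (z, z)) ∈ Φ) :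
    IsRepresented Φ (Tame Φ Ψ₀) L F := by
  obtain ⟨ν₀, hν₀⟩ := hL.nonempty
  refine ⟨fun x y hxy hx => ?_, fun x y hxy ho => ?_⟩
  · obtain ⟨n, hn, hxn⟩ := hx.exists_eq
    have hn0 : 0 ≤ n := by rcases hn with rfl | rfl <;> norm_num
    have hside : ∀ θ ∈ Θ, (fun z => θ.pair x y (n, z)) ∈ Φ := fun θ hθ => by
      rcases hn with rfl | rfl
      exacts [h0 θ hθ x y, h1 θ hθ x y]
    by_cases hy : IntegralOn y L
    · -- the region is a point
      obtain ⟨m, hm, hym⟩ := hy.exists_eq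
      obtain ⟨θ, hθ, h⟩ := hF.2 ν₀ hν₀
      have hpt : ∀ ν ∈ L, F ν = θ.pair x y (n, m) := by
        intro ν hν
        have : ν = ν₀ := by
          rw [← pairValuation_coe hX hxy ν, ← pairValuation_coe hX hxy ν₀, hxn ν hν, hym ν hν,
            hxn ν₀ hν₀, hym ν₀ hν₀]
        rw [this, h, θ.eval_eq_pair hX hxy, hxn ν₀ hν₀, hym ν₀ hν₀]
      refine ⟨fun _ => θ.pair x y (n, m), ⟨continuous_const, fun z _ =>
        ⟨fun _ => θ.pair x y (n, m), ?_, rfl⟩⟩, hpt⟩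
      rcases hm with rfl | rfl
      · exact H.const₁ _ (hside θ hθ)
      · exact H.const_one (hside θ hθ)
    · have hy0 : ∀ ν ∈ L, ν y ≠ 0 := fun ν hν h =>
        hy (Or.inl fun μ hμ => (hL.eq_zero_iff hν hμ y).2 h)
      have hy1 : ∀ ν ∈ L, ν y ≠ 1 := fun ν hν h =>
        hy (Or.inr fun μ hμ => (hL.eq_one_iff hν hμ y).2 h)
      have hmem : ∀ z ∈ Ioo (0 : ℝ) 1, pairValuation x (n, z) ∈ L := by
        intro z hz
        have ex : pairValuation x (n, z) x = ν₀ x := by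
          rw [pairValuation_left, ← hxn ν₀ hν₀, Real.toNNReal_coe]
        have ey : pairValuation x (n, z) y = z.toNNReal := pairValuation_right hxy _
        have hz0 : 0 < z.toNNReal := Real.toNNReal_pos.2 hz.1
        have hz1 : z.toNNReal < 1 := Real.toNNReal_lt_one.2 hz.2
        have hνy0 : 0 < ν₀ y := pos_iff_ne_zero.2 (hy0 ν₀ hν₀)
        have hνy1 : ν₀ y < 1 := lt_of_le_of_ne (hL.le_one hν₀ y) (hy1 ν₀ hν₀)
        have hx01 : ν₀ x = 0 ∨ ν₀ x = 1 := hx.imp (fun h => h ν₀ hν₀) (fun h => h ν₀ hν₀)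
        refine hL.mem_of_pair hX hxy hν₀ ?_ ?_ ?_ ?_ ?_ ?_ ?_ ?_ <;> simp only [ex, ey]
        · exact hL.le_one hν₀ x
        · exact hz1.le
        · exact ⟨fun h => absurd h hz0.ne', fun h => absurd h hνy0.ne'⟩
        · exact ⟨fun h => absurd h hz1.ne, fun h => absurd h hνy1.ne⟩
        · rcases hx01 with h | h <;> rw [h]
          · exact ⟨fun _ => hνy0, fun _ => hz0⟩
          · exact ⟨fun h => absurd h hz1.not_gt, fun h => absurd h hνy1.not_gt⟩
        · rcases hx01 with h | h <;> rw [h]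
          · exact ⟨fun h => absurd h hz0.not_gt, fun h => absurd h hνy0.not_gt⟩
          · exact ⟨fun _ => hνy1, fun _ => hz1⟩
      obtain ⟨f, hf, h⟩ := exists_extension_along_path H hF
        (γ := fun z => pairValuation x (n, z))
        ((continuous_pairValuation x).comp (by fun_prop)) hmem
        (fun θ hθ => ⟨_, hside θ hθ, fun z hz => eval_pairValuation hX hxy θ hn0 hz.1.le⟩)
      refine ⟨f, hf, fun ν hν => ?_⟩
      have hz : (ν y : ℝ) ∈ Ioo (0 : ℝ) 1 := by
        have a1 : 0 < ν y := pos_iff_ne_zero.2 (hy0 ν hν)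
        have a2 : ν y < 1 := lt_of_le_of_ne (hL.le_one hν y) (hy1 ν hν)
        exact ⟨by exact_mod_cast a1, by exact_mod_cast a2⟩
      rw [← h _ hz, ← hxn ν hν, pairValuation_coe hX hxy]
  · obtain ⟨o1, o2, o3⟩ := ho ν₀ hν₀
    have hmem : ∀ a b : ℝ, 0 < a → a ≤ b → b < 1 → (a < b ↔ ν₀ x < ν₀ y) →
        pairValuation x (a, b) ∈ L := by
      intro a b ha hab hb hlt
      have ex : pairValuation x (a, b) x = a.toNNReal := pairValuation_left _ _
      have ey : pairValuation x (a, b) y = b.toNNReal := pairValuation_right hxy _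
      have ha0 : 0 < a.toNNReal := Real.toNNReal_pos.2 ha
      have hb1 : b.toNNReal < 1 := Real.toNNReal_lt_one.2 hb
      have hab' : a.toNNReal ≤ b.toNNReal := Real.toNNReal_le_toNNReal hab
      have iff_of_not : ∀ {p q : Prop}, ¬p → ¬q → (p ↔ q) := fun hp hq =>
        ⟨fun h => absurd h hp, fun h => absurd h hq⟩
      refine hL.mem_of_pair hX hxy hν₀ ?_ ?_ ?_ ?_ ?_ ?_ ?_ ?_ <;> simp only [ex, ey]
      · exact (hab'.trans hb1.le)
      · exact hb1.le
      · exact iff_of_not ha0.ne' o1.ne'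
      · exact iff_of_not (ha0.trans_le hab').ne' (o1.trans_le o2).ne'
      · exact iff_of_not (hab'.trans_lt hb1).ne (o2.trans_lt o3).ne
      · exact iff_of_not hb1.ne o3.ne
      · rw [Real.toNNReal_lt_toNNReal_iff (ha.trans_le hab)]
        exact hlt
      · exact iff_of_not hab'.not_gt o2.not_gt
    rcases o2.eq_or_lt with heq | hlt
    · -- the region is the open diagonal
      have hdiagL : ∀ ν ∈ L, ν x = ν y := fun ν hν =>
        le_antisymm (ho ν hν).2.1
          (not_lt.1 fun h => heq.not_lt ((hL.lt_iff hν₀ hν x y).1 h))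
      obtain ⟨f, hf, h⟩ := exists_extension_along_path H hF
        (γ := fun z => pairValuation x (z, z))
        ((continuous_pairValuation x).comp (by fun_prop))
        (fun z hz => hmem z z hz.1 le_rfl hz.2
          ⟨fun h => absurd h (lt_irrefl _), fun h => absurd h heq.not_lt⟩)
        (fun θ hθ => ⟨_, hd θ hθ x y, fun z hz => eval_pairValuation hX hxy θ hz.1.le hz.1.le⟩)
      refine ⟨_, tame_snd H hf, fun ν hν => ?_⟩
      obtain ⟨a1, a2, a3⟩ := ho.coe hν
      have e := h (ν y) ⟨a1.trans_le a2, a3⟩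
      have e' := pairValuation_coe hX hxy ν
      rw [hdiagL ν hν] at e'
      rw [e'] at e
      exact e
    · have hltL : ∀ ν ∈ L, ν x < ν y := fun ν hν => (hL.lt_iff hν₀ hν x y).2 hlt
      have hmapsTo : ∀ p ∈ {p : ℝ × ℝ | 0 < p.1 ∧ p.1 < p.2 ∧ p.2 < 1},
          pairValuation x p ∈ L := fun p hp =>
        hmem p.1 p.2 hp.1 hp.2.1.le hp.2.2 ⟨fun _ => hlt, fun _ => hp.2.1⟩
      obtain ⟨g, hg, hge, hgs⟩ := exists_continuous_extension_of_selection convex_open_triangle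
        H.finite₂ (fun ψ hψ => (H.affine₂ ψ hψ).lipschitz) (f := fun p => F (pairValuation x p))
        (hF.1.comp (continuous_pairValuation x).continuousOn hmapsTo) (fun p hp => by
          obtain ⟨θ, hθ, h⟩ := hF.2 _ (hmapsTo p hp)
          exact ⟨_, hΨ θ hθ x y, by
            rw [h, eval_pairValuation hX hxy θ hp.1.le (hp.1.trans hp.2.1).le]⟩)
      refine ⟨g, tame_of_output H ⟨hg, fun p hp => hgs p (triangle_subset_closure hp)⟩,
        fun ν hν => ?_⟩
      obtain ⟨a1, a2, a3⟩ := ho.coe hν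
      rw [← hge ⟨a1, by exact_mod_cast hltL ν hν, a3⟩]
      simp only [pairValuation_coe hX hxy]

end Outputs

/-! ### Value iteration -/

namespace KernelWTG

variable {L X : Type*} [Fintype X] (G : KernelWTG L X) {K : Subfield ℝ} {Φ : Set (ℝ → ℝ)}
  {Ψ₀ : Set (ℝ × ℝ → ℝ)}

lemma opt_goal {l : L} (hl : l ∈ G.goals) (k : ℕ) (ν : Valuation X) :
    G.opt k l ν = (G.out l ν : EReal) := by
  cases k <;> simp [opt, hl]

lemma opt_zero {l : L} (hl : l ∉ G.goals) (ν : Valuation X) : G.opt 0 l ν = ⊤ := by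
  simp [opt, hl]

lemma opt_succ_min {l : L} (hl : l ∉ G.goals) (ho : G.owner l = Player.min) (k : ℕ)
    (ν : Valuation X) : G.opt (k + 1) l ν = ⨅ (m : Move L X) (_ : G.Enabled ⟨l, ν⟩ m),
      G.opt k m.2.target ((ν.delay m.1).reset m.2.resets) := by
  simp [opt, hl, ho]

lemma opt_succ_max {l : L} (hl : l ∉ G.goals) (ho : G.owner l = Player.max) (k : ℕ)
    (ν : Valuation X) : G.opt (k + 1) l ν = ⨆ (m : Move L X) (_ : G.Enabled ⟨l, ν⟩ m),
      G.opt k m.2.target ((ν.delay m.1).reset m.2.resets) := by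
  simp [opt, hl, ho]

lemma opt_succ_le (k : ℕ) : ∀ l ν, G.opt (k + 1) l ν ≤ G.opt k l ν := by
  induction k with
  | zero =>
    intro l ν
    by_cases hl : l ∈ G.goals
    · rw [opt_goal G hl, opt_goal G hl]
    · rw [opt_zero G hl]
      exact le_top
  | succ k ih =>
    intro l ν
    by_cases hl : l ∈ G.goals
    · rw [opt_goal G hl, opt_goal G hl]
    · cases ho : G.owner l
      · rw [opt_succ_min G hl ho, opt_succ_min G hl ho]
        exact iInf₂_mono fun m _ => ih _ _
      · rw [opt_succ_max G hl ho, opt_succ_max G hl ho]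
        exact iSup₂_mono fun m _ => ih _ _

lemma opt_antitone (l : L) (ν : Valuation X) : Antitone fun k => G.opt k l ν :=
  antitone_nat_of_succ_le fun k => G.opt_succ_le k l ν

lemma next_mem_reg {c : Config L X} (hc : c.val ∈ G.reg c.loc) {m : Move L X}
    (hm : G.Enabled c m) : (c.next m).val ∈ G.reg (c.next m).loc := by
  obtain ⟨r, -, h1, h2⟩ := G.reg_trans m.2 hm.1
  change (c.val.delay m.1).reset m.2.resets ∈ G.reg m.2.target
  rw [← h2]
  exact ⟨_, h1 _ (hm.2.1 ▸ hc) _ hm.2.2, rfl⟩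

/-- A transition that is possible somewhere in the region of its source is possible everywhere in
it, and then its delays are those that lead into one fixed region. -/
lemma exists_region_of_live (hX : Fintype.card X = 2) {t : Transition L X} (ht : t ∈ G.trans)
    {ν₀ : Valuation X} {d₀ : ℝ≥0} (hν₀ : ν₀ ∈ G.reg t.source) (hsat : (ν₀.delay d₀).Sat t.guard) :
    ∃ r, IsRegion r ∧ ν₀.delay d₀ ∈ r ∧ (fun ν => ν.reset t.resets) '' r = G.reg t.target ∧
      ∀ ν ∈ G.reg t.source, (∃ d, ν.delay d ∈ r) ∧
        ∀ d, (ν.delay d).Sat t.guard ↔ ν.delay d ∈ r := by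
  obtain ⟨r, hr, h1, h2⟩ := G.reg_trans t ht
  have h₀ := h1 ν₀ hν₀ d₀ hsat
  have hL := G.reg_isRegion t.source
  refine ⟨r, hr, h₀, h2, fun ν hν => ⟨?_, fun d => ⟨h1 ν hν d, fun h => hr.sat_of_sat h₀ h hsat⟩⟩⟩
  obtain ⟨x, y, hxy⟩ := Fintype.exists_pair_of_one_lt_card (α := X) (by omega)
  have hint : ∀ x, IntegralOn x r → ∃ d, ν.delay d ∈ r := fun x hx =>
    (hL.exists_unique_delay hr hν₀ h₀ hx hν).imp fun d hd => hd.1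
  have hopen : ∀ x y, x ≠ y → OpenOn x y r → ∃ d, ν.delay d ∈ r := by
    intro x y hxy ho
    obtain ⟨-, hlt, hd⟩ := hL.delay_mem_iff hX hxy hr hν₀ h₀ ho hν
    obtain ⟨z, hz1, hz2⟩ := exists_between hlt
    refine ⟨z - ν y, (hd _).2 ⟨?_, ?_⟩⟩
    · exact lt_of_lt_of_le (tsub_pos_of_lt hz1) le_add_self
    · rwa [add_tsub_cancel_of_le hz1.le]
  rcases hr.integralOn_or_openOn x y with h | h | h | h
  · exact hint x h
  · exact hint y h
  · exact hopen x y hxy h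
  · exact hopen y x hxy.symm h

/-- On the region of `l`, the function `V` is identically `+∞` or represented by a function of
class `𝓒`. -/
def IsTopOrRepresented (Φ : Set (ℝ → ℝ)) (𝓒 : (ℝ × ℝ → ℝ) → Prop) (l : L)
    (V : Valuation X → EReal) : Prop :=
  (∀ ν ∈ G.reg l, V ν = ⊤) ∨ ∃ F, IsRepresented Φ 𝓒 (G.reg l) F ∧ ∀ ν ∈ G.reg l, V ν = F ν

section Step

variable {V : L → Valuation X → EReal}

lemma isTopOrRepresented_transition_min (hX : Fintype.card X = 2) (H : IsClosedFamily K Φ Ψ₀)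
    (hV : ∀ l, G.IsTopOrRepresented Φ (Tame Φ Ψ₀) l (V l)) {t : Transition L X}
    (ht : t ∈ G.trans) :
    G.IsTopOrRepresented Φ (Rising Φ Ψ₀) t.source fun ν =>
      ⨅ (d : ℝ≥0) (_ : (ν.delay d).Sat t.guard), V t.target ((ν.delay d).reset t.resets) := by
  by_cases hlive : ∃ ν₀ ∈ G.reg t.source, ∃ d₀, (ν₀.delay d₀).Sat t.guard
  swap
  · left
    intro ν hν
    simp only [iInf_eq_top]
    exact fun d hd => absurd ⟨ν, hν, d, hd⟩ hlive
  obtain ⟨ν₀, hν₀, d₀, hsat⟩ := hlive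
  obtain ⟨r, hr, h₀, himg, hdel⟩ := G.exists_region_of_live hX ht hν₀ hsat
  rcases hV t.target with htop | ⟨F, hF, hVF⟩
  · left
    intro ν hν
    simp only [iInf_eq_top]
    intro d hd
    exact htop _ (himg ▸ ⟨_, ((hdel ν hν).2 d).1 hd, rfl⟩)
  · right
    obtain ⟨F', hF', hinf⟩ := exists_isDelayInf hX H (G.reg_isRegion _) hr hν₀ h₀
      (hF.comp_reset hX H himg)
    have hval : ∀ (ν : Valuation X) d, ν.delay d ∈ r →
        V t.target ((ν.delay d).reset t.resets) = F ((ν.delay d).reset t.resets) := fun ν d h =>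
      hVF _ (himg ▸ ⟨_, h, rfl⟩)
    refine ⟨F', hF', fun ν hν => le_antisymm ?_ ?_⟩
    · refine (hinf ν hν).2 _ fun d hd => ?_
      rw [← hval ν d hd]
      exact iInf₂_le d (((hdel ν hν).2 d).2 hd)
    · refine le_iInf₂ fun d hd => ?_
      have hd' := ((hdel ν hν).2 d).1 hd
      rw [hval ν d hd']
      exact_mod_cast (hinf ν hν).1 d hd'

lemma isTopOrRepresented_transition_max (hX : Fintype.card X = 2) (H : IsClosedFamily K Φ Ψ₀)
    (hV : ∀ l, G.IsTopOrRepresented Φ (Tame Φ Ψ₀) l (V l)) {t : Transition L X}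
    (ht : t ∈ G.trans) :
    (∀ ν ∈ G.reg t.source,
      ⨆ (d : ℝ≥0) (_ : (ν.delay d).Sat t.guard), V t.target ((ν.delay d).reset t.resets) = ⊥) ∨
    G.IsTopOrRepresented Φ (fun g => Rising Φ Ψ₀ fun p => -g p) t.source fun ν =>
      ⨆ (d : ℝ≥0) (_ : (ν.delay d).Sat t.guard), V t.target ((ν.delay d).reset t.resets) := by
  by_cases hlive : ∃ ν₀ ∈ G.reg t.source, ∃ d₀, (ν₀.delay d₀).Sat t.guard
  swap
  · left
    intro ν hν
    simp only [iSup_eq_bot]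
    exact fun d hd => absurd ⟨ν, hν, d, hd⟩ hlive
  right
  obtain ⟨ν₀, hν₀, d₀, hsat⟩ := hlive
  obtain ⟨r, hr, h₀, himg, hdel⟩ := G.exists_region_of_live hX ht hν₀ hsat
  rcases hV t.target with htop | ⟨F, hF, hVF⟩
  · left
    intro ν hν
    obtain ⟨d, hd⟩ := (hdel ν hν).1
    rw [eq_top_iff, ← htop _ (himg ▸ ⟨_, hd, rfl⟩ : (ν.delay d).reset t.resets ∈ G.reg t.target)]
    exact le_iSup₂ (f := fun d (_ : (ν.delay d).Sat t.guard) =>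
      V t.target ((ν.delay d).reset t.resets)) d (((hdel ν hν).2 d).2 hd)
  · right
    obtain ⟨F', hF', hinf⟩ := exists_isDelayInf hX H (G.reg_isRegion _) hr hν₀ h₀
      ((hF.comp_reset hX H himg).neg H fun g hg => hg.neg H)
    have hval : ∀ (ν : Valuation X) d, ν.delay d ∈ r →
        V t.target ((ν.delay d).reset t.resets) = F ((ν.delay d).reset t.resets) := fun ν d h =>
      hVF _ (himg ▸ ⟨_, h, rfl⟩)
    refine ⟨fun ν => -F' ν, hF'.neg H fun g hg => by simpa using hg,
      fun ν hν => le_antisymm ?_ ?_⟩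
    · refine iSup₂_le fun d hd => ?_
      have hd' := ((hdel ν hν).2 d).1 hd
      rw [hval ν d hd', EReal.coe_le_coe_iff]
      have := (hinf ν hν).1 d hd'
      linarith
    · rw [EReal.coe_neg, EReal.neg_le]
      refine (hinf ν hν).2 _ fun d hd => ?_
      rw [EReal.coe_neg, EReal.neg_le_neg_iff, ← hval ν d hd]
      exact le_iSup₂ (f := fun d (_ : (ν.delay d).Sat t.guard) =>
        V t.target ((ν.delay d).reset t.resets)) d (((hdel ν hν).2 d).2 hd)

lemma IsTopOrRepresented.inf {𝓒 : (ℝ × ℝ → ℝ) → Prop} {l : L} {A B : Valuation X → EReal}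
    (h𝓒 : ∀ g g', 𝓒 g → 𝓒 g' → 𝓒 (fun p => g p ⊓ g' p))
    (hA : G.IsTopOrRepresented Φ 𝓒 l A) (hB : G.IsTopOrRepresented Φ 𝓒 l B) :
    G.IsTopOrRepresented Φ 𝓒 l (fun ν => A ν ⊓ B ν) := by
  rcases hA with hA | ⟨F, hF, hA⟩ <;> rcases hB with hB | ⟨F', hF', hB⟩
  · exact Or.inl fun ν hν => by simp only [hA ν hν, hB ν hν, le_refl, inf_of_le_left]
  · exact Or.inr ⟨F', hF', fun ν hν => by simp only [hA ν hν, hB ν hν, le_top, inf_of_le_right]⟩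
  · exact Or.inr ⟨F, hF, fun ν hν => by simp only [hA ν hν, hB ν hν, le_top, inf_of_le_left]⟩
  · refine Or.inr ⟨_, hF.min h𝓒 hF', fun ν hν => ?_⟩
    simp only [hA ν hν, hB ν hν]
    exact (EReal.coe_strictMono.monotone.map_min).symm

lemma IsTopOrRepresented.sup (H : IsClosedFamily K Φ Ψ₀) {l : L} {A B : Valuation X → EReal}
    (hA : G.IsTopOrRepresented Φ (fun g => Rising Φ Ψ₀ fun p => -g p) l A)
    (hB : G.IsTopOrRepresented Φ (fun g => Rising Φ Ψ₀ fun p => -g p) l B) :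
    G.IsTopOrRepresented Φ (fun g => Rising Φ Ψ₀ fun p => -g p) l (fun ν => A ν ⊔ B ν) := by
  rcases hA with hA | ⟨F, hF, hA⟩
  · exact Or.inl fun ν hν => by simp only [hA ν hν, le_top, sup_of_le_left]
  rcases hB with hB | ⟨F', hF', hB⟩
  · exact Or.inl fun ν hν => by simp only [hB ν hν, le_top, sup_of_le_right]
  have h := ((hF.neg H (𝓒' := Rising Φ Ψ₀) fun g hg => hg).min (fun g g' hg hg' => hg.min hg')
    (hF'.neg H fun g hg => hg)).neg H (𝓒' := fun g => Rising Φ Ψ₀ fun p => -g p)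
    fun g hg => by simpa using hg
  refine Or.inr ⟨_, h, fun ν hν => ?_⟩
  simp only [hA ν hν, hB ν hν, min_neg_neg, neg_neg]
  exact (EReal.coe_strictMono.monotone.map_max).symm

lemma isTopOrRepresented_min (hX : Fintype.card X = 2) (H : IsClosedFamily K Φ Ψ₀)
    (hV : ∀ l, G.IsTopOrRepresented Φ (Tame Φ Ψ₀) l (V l)) (l : L) :
    G.IsTopOrRepresented Φ (Rising Φ Ψ₀) l fun ν => ⨅ (m : Move L X)
      (_ : G.Enabled ⟨l, ν⟩ m), V m.2.target ((ν.delay m.1).reset m.2.resets) := by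
  classical
  have h : ∀ S : Finset (Transition L X), (∀ t ∈ S, t ∈ G.trans ∧ t.source = l) →
      G.IsTopOrRepresented Φ (Rising Φ Ψ₀) l fun ν => ⨅ t ∈ S, ⨅ (d : ℝ≥0)
        (_ : (ν.delay d).Sat t.guard), V t.target ((ν.delay d).reset t.resets) := by
    intro S
    induction S using Finset.induction_on with
    | empty => exact fun _ => Or.inl fun ν _ => by simp
    | insert t S _ ih =>
      intro hS
      simp only [Finset.iInf_insert]
      obtain ⟨ht, rfl⟩ := hS t (Finset.mem_insert_self _ _)
      exact IsTopOrRepresented.inf G (fun g g' hg hg' => hg.min hg')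
        (G.isTopOrRepresented_transition_min hX H hV ht)
        (ih fun t' ht' => hS t' (Finset.mem_insert_of_mem ht'))
  have h' := h (G.trans.filter fun t => t.source = l) (by simp)
  convert h' using 2 with ν
  refine le_antisymm (le_iInf₂ fun t ht => le_iInf₂ fun d hd => ?_)
    (le_iInf₂ fun m hm => ?_)
  · rw [Finset.mem_filter] at ht
    exact iInf₂_le (f := fun (m : Move L X) (_ : G.Enabled ⟨l, ν⟩ m) =>
      V m.2.target ((ν.delay m.1).reset m.2.resets)) (d, t) ⟨ht.1, ht.2, hd⟩
  · exact (iInf₂_le m.2 (Finset.mem_filter.2 ⟨hm.1, hm.2.1⟩)).trans (iInf₂_le m.1 hm.2.2)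

lemma isTopOrRepresented_max (hX : Fintype.card X = 2) (H : IsClosedFamily K Φ Ψ₀)
    (hV : ∀ l, G.IsTopOrRepresented Φ (Tame Φ Ψ₀) l (V l)) {l : L} (hl : l ∉ G.goals) :
    G.IsTopOrRepresented Φ (fun g => Rising Φ Ψ₀ fun p => -g p) l fun ν => ⨆ (m : Move L X)
      (_ : G.Enabled ⟨l, ν⟩ m), V m.2.target ((ν.delay m.1).reset m.2.resets) := by
  classical
  have h : ∀ S : Finset (Transition L X), (∀ t ∈ S, t ∈ G.trans ∧ t.source = l) →
      (∀ ν ∈ G.reg l, ⨆ t ∈ S, ⨆ (d : ℝ≥0) (_ : (ν.delay d).Sat t.guard),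
        V t.target ((ν.delay d).reset t.resets) = ⊥) ∨
      G.IsTopOrRepresented Φ (fun g => Rising Φ Ψ₀ fun p => -g p) l fun ν => ⨆ t ∈ S,
        ⨆ (d : ℝ≥0) (_ : (ν.delay d).Sat t.guard), V t.target ((ν.delay d).reset t.resets) := by
    intro S
    induction S using Finset.induction_on with
    | empty => exact fun _ => Or.inl fun ν _ => by simp
    | insert t S _ ih =>
      intro hS
      simp only [Finset.iSup_insert]
      obtain ⟨ht, rfl⟩ := hS t (Finset.mem_insert_self _ _)
      have h2 := ih fun t' ht' => hS t' (Finset.mem_insert_of_mem ht')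
      rcases G.isTopOrRepresented_transition_max hX H hV ht with h1 | h1 <;>
        rcases h2 with h2 | h2
      · exact Or.inl fun ν hν => by rw [h1 ν hν, h2 ν hν, bot_sup_eq]
      · refine Or.inr (h2.imp (fun h ν hν => ?_) fun ⟨F, hF, h⟩ => ⟨F, hF, fun ν hν => ?_⟩)
        · simp only [h1 ν hν, bot_sup_eq]
          exact h ν hν
        · simp only [h1 ν hν, bot_sup_eq]
          exact h ν hν
      · refine Or.inr (h1.imp (fun h ν hν => ?_) fun ⟨F, hF, h⟩ => ⟨F, hF, fun ν hν => ?_⟩)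
        · simp only [h2 ν hν, sup_bot_eq]
          exact h ν hν
        · simp only [h2 ν hν, sup_bot_eq]
          exact h ν hν
      · exact Or.inr (IsTopOrRepresented.sup G H h1 h2)
  have hconv : ∀ ν, (⨆ (m : Move L X) (_ : G.Enabled ⟨l, ν⟩ m),
      V m.2.target ((ν.delay m.1).reset m.2.resets)) =
      ⨆ t ∈ G.trans.filter fun t => t.source = l, ⨆ (d : ℝ≥0) (_ : (ν.delay d).Sat t.guard),
        V t.target ((ν.delay d).reset t.resets) := by
    intro ν
    refine le_antisymm (iSup₂_le fun m hm => ?_)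
      (iSup₂_le fun t ht => iSup₂_le fun d hd => ?_)
    · exact (le_iSup₂ (f := fun d (_ : (ν.delay d).Sat m.2.guard) =>
        V m.2.target ((ν.delay d).reset m.2.resets)) m.1 hm.2.2).trans
        (le_iSup₂ (f := fun t (_ : t ∈ G.trans.filter fun t => t.source = l) =>
          ⨆ (d : ℝ≥0) (_ : (ν.delay d).Sat t.guard), V t.target ((ν.delay d).reset t.resets))
          m.2 (Finset.mem_filter.2 ⟨hm.1, hm.2.1⟩))
    · rw [Finset.mem_filter] at ht
      exact le_iSup₂ (f := fun (m : Move L X) (_ : G.Enabled ⟨l, ν⟩ m) =>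
        V m.2.target ((ν.delay m.1).reset m.2.resets)) (d, t) ⟨ht.1, ht.2, hd⟩
  simp only [hconv]
  refine (h (G.trans.filter fun t => t.source = l) (by simp)).resolve_left fun hbot => ?_
  -- some move is possible, and no value is `-∞`
  obtain ⟨ν, hν⟩ := (G.reg_isRegion l).nonempty
  obtain ⟨m, hm⟩ := G.deadlock_free l hl ν hν
  have hb := hbot ν hν
  rw [← hconv] at hb
  simp only [iSup_eq_bot] at hb
  have hb' := hb m hm
  have hmem : (ν.delay m.1).reset m.2.resets ∈ G.reg m.2.target :=
    G.next_mem_reg (c := ⟨l, ν⟩) hν hm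
  rcases hV m.2.target with h' | ⟨F, -, h'⟩ <;> rw [h' _ hmem] at hb'
  · exact absurd hb' top_ne_bot
  · exact EReal.coe_ne_bot _ hb'

/-- All value iteration functions are represented. -/
lemma isTopOrRepresented_opt (hX : Fintype.card X = 2) (H : IsClosedFamily K Φ Ψ₀)
    (hout : ∀ l ∈ G.goals, IsRepresented Φ (Tame Φ Ψ₀) (G.reg l) (G.out l)) (k : ℕ) :
    ∀ l, G.IsTopOrRepresented Φ (Tame Φ Ψ₀) l (G.opt k l) := by
  have hgoal : ∀ k, ∀ l ∈ G.goals, G.IsTopOrRepresented Φ (Tame Φ Ψ₀) l (G.opt k l) :=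
    fun k l hl => Or.inr ⟨_, hout l hl, fun ν _ => G.opt_goal hl k ν⟩
  induction k with
  | zero =>
    intro l
    by_cases hl : l ∈ G.goals
    · exact hgoal 0 l hl
    · exact Or.inl fun ν _ => G.opt_zero hl ν
  | succ k ih =>
    intro l
    by_cases hl : l ∈ G.goals
    · exact hgoal _ l hl
    · cases ho : G.owner l
      · rw [funext (G.opt_succ_min hl ho k)]
        exact (G.isTopOrRepresented_min hX H ih l).imp id fun ⟨F, hF, h⟩ =>
          ⟨F, hF.mono fun g hg => hg.tame H, h⟩
      · rw [funext (G.opt_succ_max hl ho k)]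
        exact (G.isTopOrRepresented_max hX H ih hl).imp id fun ⟨F, hF, h⟩ =>
          ⟨F, hF.mono fun g hg => by simpa using (hg.tame H).neg H, h⟩

end Step

/-- All value iteration functions are, where finite, continuous selections of one finite set of
affine forms, over any field over which the outputs are piecewise linear. -/
lemma exists_forms_of_opt [Finite L] (hX : Fintype.card X = 2)
    (hK : ∀ l ∈ G.goals, PiecewiseLinearOver K (G.out l) (G.reg l)) :
    ∃ Θ : Set (AffineForm X), Θ.Finite ∧ (∀ θ ∈ Θ, θ.Over K) ∧ ∀ k l,
      (∀ ν ∈ G.reg l, G.opt k l ν = ⊤) ∨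
        ∃ F, IsFormSelection Θ (G.reg l) F ∧ ∀ ν ∈ G.reg l, G.opt k l ν = F ν := by
  have hforms : ∀ l : G.goals, ∃ Θ : Set (AffineForm X), Θ.Finite ∧ (∀ θ ∈ Θ, θ.Over K) ∧
      IsFormSelection Θ (G.reg l) (G.out l) := by
    intro l
    obtain ⟨m, P, g, -, hg, hcov, heq⟩ := hK l l.2
    refine ⟨range g, finite_range g, by rintro _ ⟨i, rfl⟩; exact hg i,
      G.out_continuousOn l l.2, fun ν hν => ?_⟩
    obtain ⟨i, hi⟩ := hcov ν hν
    exact ⟨g i, ⟨i, rfl⟩, heq i ν hν hi⟩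
  choose Θ hΘf hΘK hΘ using hforms
  let Ψ : Set (ℝ × ℝ → ℝ) := ⋃ l, Set.image2 (fun θ (k : X × X) => θ.pair k.1 k.2) (Θ l) univ
  have hΨ : ∀ l, ∀ θ ∈ Θ l, ∀ x y, θ.pair x y ∈ Ψ := fun l θ hθ x y =>
    mem_iUnion.2 ⟨l, θ, hθ, (x, y), mem_univ _, rfl⟩
  have hΨf : Ψ.Finite := finite_iUnion fun l => (hΘf l).image2 _ finite_univ
  have hΨK : ∀ ψ ∈ Ψ, IsAffine₂ K ψ := by
    intro ψ hψ
    obtain ⟨l, θ, hθ, k, -, rfl⟩ := mem_iUnion.1 hψ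
    obtain ⟨h1, h2⟩ := hΘK l θ hθ
    exact ⟨_, h1 _, _, h1 _, _, h2, fun u => rfl⟩
  obtain ⟨Φ, Ψ₀, H, hΦsub, hΨsub⟩ := exists_closedFamily (K := K)
    (Φ := ((fun ψ z => ψ (0, z)) '' Ψ ∪ (fun ψ z => ψ (1, z)) '' Ψ) ∪ (fun ψ z => ψ (z, z)) '' Ψ)
    (((hΨf.image _).union (hΨf.image _)).union (hΨf.image _))
    (by
      rintro _ ((⟨ψ, hψ, rfl⟩ | ⟨ψ, hψ, rfl⟩) | ⟨ψ, hψ, rfl⟩) <;>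
        obtain ⟨a, ha, b, hb, c, hc, h⟩ := hΨK ψ hψ
      · exact ⟨b, hb, c, hc, fun z => by simp only [h]; ring⟩
      · exact ⟨b, hb, a + c, add_mem ha hc, fun z => by simp only [h]; ring⟩
      · exact ⟨a + b, add_mem ha hb, c, hc, fun z => by simp only [h]; ring⟩)
    hΨf hΨK
  have hout : ∀ l ∈ G.goals, IsRepresented Φ (Tame Φ Ψ₀) (G.reg l) (G.out l) := by
    intro l hl
    refine (hΘ ⟨l, hl⟩).isRepresented hX H (G.reg_isRegion l) ?_ ?_ ?_ ?_ <;>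
      intro θ hθ x y
    · exact hΨsub (hΨ ⟨l, hl⟩ θ hθ x y)
    · exact hΦsub (Or.inl (Or.inl ⟨_, hΨ ⟨l, hl⟩ θ hθ x y, rfl⟩))
    · exact hΦsub (Or.inl (Or.inr ⟨_, hΨ ⟨l, hl⟩ θ hθ x y, rfl⟩))
    · exact hΦsub (Or.inr ⟨_, hΨ ⟨l, hl⟩ θ hθ x y, rfl⟩)
  obtain ⟨Θ', hf, hK', hsel⟩ := exists_forms_of_isRepresented hX H
  refine ⟨Θ', hf, hK', fun k l => (G.isTopOrRepresented_opt hX H hout k l).imp id ?_⟩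
  exact fun ⟨F, hF, h⟩ => ⟨F, hsel _ F (G.reg_isRegion l) (hF.mono fun g hg => hg.1), h⟩

/-- Value iteration is stationary from some point on: it is a decreasing sequence in a finite set
of functions. -/
lemma exists_opt_succ_eq [Finite L] (hX : Fintype.card X = 2) :
    ∃ k, ∀ l, ∀ ν ∈ G.reg l, G.opt (k + 1) l ν = G.opt k l ν := by
  obtain ⟨Θ, hΘ, -, hsel⟩ := G.exists_forms_of_opt hX (K := ⊤) G.out_piecewiseLinearOn
  have hfin : ∀ l, {V : G.reg l → EReal | (∀ ν, V ν = ⊤) ∨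
      ∃ F, IsFormSelection Θ (G.reg l) F ∧ ∀ ν, V ν = F ν}.Finite := by
    intro l
    refine ((finite_singleton (fun _ => ⊤)).union ((finite_isFormSelection hΘ
      (G.reg_isRegion l).convex (G.reg_isRegion l).nonempty).image
        fun (F : G.reg l → ℝ) ν => (F ν : EReal))).subset ?_
    rintro V (h | ⟨F, hF, h⟩)
    · exact Or.inl (funext h)
    · exact Or.inr ⟨fun ν => F ν, ⟨F, hF, fun _ => rfl⟩, funext fun ν => (h ν).symm⟩
  obtain ⟨i, -, j, -, hij, heq⟩ := infinite_univ.exists_lt_map_eq_of_mapsTo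
    (f := fun (k : ℕ) l (ν : G.reg l) => G.opt k l ν)
    (t := Set.pi univ fun l => {V : G.reg l → EReal | (∀ ν, V ν = ⊤) ∨
      ∃ F, IsFormSelection Θ (G.reg l) F ∧ ∀ ν, V ν = F ν})
    (fun k _ l _ => (hsel k l).imp (fun h ν => h ν ν.2) fun ⟨F, hF, h⟩ => ⟨F, hF, fun ν => h ν ν.2⟩)
    (Set.Finite.pi' hfin |>.subset fun V hV l => hV l (mem_univ l))
  refine ⟨i, fun l ν hν => le_antisymm (G.opt_succ_le i l ν) ?_⟩
  have h1 : G.opt i l ν = G.opt j l ν := congrFun (congrFun heq l) ⟨ν, hν⟩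
  rw [h1]
  exact G.opt_antitone l ν hij

end KernelWTG

/-! ### Value iteration and the values of the game -/

lemma Run.last_snoc {L X : Type*} (ρ : Run L X) (m : Move L X) :
    (ρ.snoc m).last = ρ.last.next m := by
  simp [Run.last, Run.snoc, List.foldl_append]

namespace WTG

variable {L X : Type*} (G : WTG L X)

lemma validFrom_append_singleton {ms : List (Move L X)} {m : Move L X} {c : Config L X}
    (h : G.ValidFrom c ms) (hm : G.Enabled (ms.foldl Config.next c) m) :
    G.ValidFrom c (ms ++ [m]) := by
  induction ms generalizing c with
  | nil => exact ⟨hm, trivial⟩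
  | cons a ms ih => exact ⟨h.1, ih h.2 hm⟩

lemma IsRun.snoc {ρ : Run L X} (h : G.IsRun ρ) {m : Move L X} (hm : G.Enabled ρ.last m) :
    G.IsRun (ρ.snoc m) :=
  G.validFrom_append_singleton h hm

/-- There is a strategy that always plays a good move when there is one. -/
lemma exists_strategy (P : Player) (good : Run L X → Move L X → Prop) :
    ∃ σ : G.Strategy P, ∀ ρ, (∃ m, G.Enabled ρ.last m ∧ good ρ m) → good ρ (σ.1 ρ) := by
  classical
  have h : ∀ ρ : Run L X, ∃ m : Move L X, (G.CanMove ρ.last → G.Enabled ρ.last m) ∧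
      ((∃ m, G.Enabled ρ.last m ∧ good ρ m) → good ρ m) := by
    intro ρ
    by_cases h : ∃ m, G.Enabled ρ.last m ∧ good ρ m
    · obtain ⟨m, h1, h2⟩ := h
      exact ⟨m, fun _ => h1, fun _ => h2⟩
    · by_cases h' : G.CanMove ρ.last
      · exact ⟨h'.choose, fun _ => h'.choose_spec, fun h'' => absurd h'' h⟩
      · exact ⟨(0, ⟨ρ.start.loc, ∅, ∅, ρ.start.loc⟩), fun h'' => absurd h'' h',
          fun h'' => absurd h'' h⟩
  choose σ h1 h2 using h
  exact ⟨⟨σ, fun ρ _ _ => h1 ρ⟩, h2⟩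

end WTG

namespace KernelWTG

variable {L X : Type*} [Fintype X] (G : KernelWTG L X) {c : Config L X}
  (σ : G.Strategy Player.min) (τ : G.Strategy Player.max)

lemma movesWeight_eq_zero {ms : List (Move L X)} {c : Config L X} (h : G.ValidFrom c ms) :
    G.movesWeight c ms = 0 := by
  induction ms generalizing c with
  | nil => rfl
  | cons m ms ih =>
    have hloc : c.loc ∉ G.goals := h.1.2.1 ▸ G.source_notMem_goals m.2 h.1.1
    simp [WTG.movesWeight, ih h.2, G.locWeight_zero c.loc hloc, G.transWeight_zero m.2 h.1.1]

/-- One round of a play, at a configuration of the game that is not a goal. -/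
lemma play_succ {n : ℕ} (hrun : G.IsRun (G.play c σ τ n))
    (hreg : (G.play c σ τ n).last.val ∈ G.reg (G.play c σ τ n).last.loc)
    (hgoal : (G.play c σ τ n).last.loc ∉ G.goals) :
    ∃ m, G.play c σ τ (n + 1) = (G.play c σ τ n).snoc m ∧ G.Enabled (G.play c σ τ n).last m ∧
      (G.owner (G.play c σ τ n).last.loc = Player.min → m = σ.1 (G.play c σ τ n)) ∧
      (G.owner (G.play c σ τ n).last.loc = Player.max → m = τ.1 (G.play c σ τ n)) := by
  have hmove : G.CanMove (G.play c σ τ n).last := G.deadlock_free _ hgoal _ hreg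
  cases ho : G.owner (G.play c σ τ n).last.loc
  · exact ⟨σ.1 (G.play c σ τ n), by simp only [WTG.play, hmove, if_true, ho],
      σ.2 _ hrun ho hmove, fun _ => rfl, by simp⟩
  · exact ⟨τ.1 (G.play c σ τ n), by simp only [WTG.play, hmove, if_true, ho],
      τ.2 _ hrun ho hmove, by simp, fun _ => rfl⟩

/-- Before the first visit to a goal, the prefixes of a play are runs within the regions, and an
invariant that every round preserves holds along them. -/
lemma play_invariant (hc : c.val ∈ G.reg c.loc) {I : ℕ → Config L X → Prop} (h0 : I 0 c)
    (hstep : ∀ n, G.IsRun (G.play c σ τ n) → (G.play c σ τ n).moves.length = n →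
      (G.play c σ τ n).last.val ∈ G.reg (G.play c σ τ n).last.loc →
      (G.play c σ τ n).last.loc ∉ G.goals → I n (G.play c σ τ n).last →
      I (n + 1) (G.play c σ τ (n + 1)).last) (n : ℕ)
    (hn : ∀ j < n, (G.play c σ τ j).last.loc ∉ G.goals) :
    G.IsRun (G.play c σ τ n) ∧ (G.play c σ τ n).moves.length = n ∧
      (G.play c σ τ n).last.val ∈ G.reg (G.play c σ τ n).last.loc ∧ I n (G.play c σ τ n).last := by
  induction n with
  | zero => exact ⟨trivial, rfl, hc, h0⟩
  | succ n ih =>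
    obtain ⟨h1, h2, h3, h4⟩ := ih fun j hj => hn j (hj.trans n.lt_succ_self)
    have hgoal := hn n n.lt_succ_self
    have hI := hstep n h1 h2 h3 hgoal h4
    obtain ⟨m, hm, hen, -⟩ := G.play_succ σ τ h1 h3 hgoal
    refine ⟨hm ▸ WTG.IsRun.snoc G.toWTG h1 hen, ?_, ?_, hI⟩
    · rw [hm]
      simp [Run.snoc, h2]
    · rw [hm, Run.last_snoc]
      exact G.next_mem_reg h3 hen

lemma payoff_eq_out {n : ℕ} (hrun : G.IsRun (G.play c σ τ n))
    (hgoal : (G.play c σ τ n).last.loc ∈ G.goals)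
    (hn : ∀ j < n, (G.play c σ τ j).last.loc ∉ G.goals) :
    G.payoff c σ τ = (G.out (G.play c σ τ n).last.loc (G.play c σ τ n).last.val : EReal) := by
  classical
  have hex : ∃ n, (G.play c σ τ n).last.loc ∈ G.goals := ⟨n, hgoal⟩
  have hfind : Nat.find hex = n := (Nat.find_eq_iff hex).2 ⟨hgoal, hn⟩
  rw [payoff, dif_pos hex]
  have hfind' : @Nat.find _ (fun _ => Classical.propDecidable _) hex = n := by
    rw [← hfind]
  simp only [hfind', G.movesWeight_eq_zero hrun, zero_add]

/-- The minimizing player can keep the value iteration functions, with decreasing index, below any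
bound above `opt k`, and so reaches a goal within `k` rounds. -/
lemma exists_strategy_min (hc : c.val ∈ G.reg c.loc) {k : ℕ} {r : EReal}
    (hr : G.opt k c.loc c.val < r) :
    ∃ σ : G.Strategy Player.min, ∀ τ : G.Strategy Player.max, G.payoff c σ τ < r := by
  obtain ⟨σ, hσ⟩ := G.exists_strategy Player.min fun ρ m =>
    G.opt (k - ρ.moves.length - 1) (ρ.last.next m).loc (ρ.last.next m).val < r
  refine ⟨σ, fun τ => ?_⟩
  have hinv := G.play_invariant σ τ hc
    (I := fun n c => n ≤ k ∧ G.opt (k - n) c.loc c.val < r) ⟨k.zero_le, hr⟩ (by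
      rintro n hrun hlen hreg hgoal ⟨hnk, hlt⟩
      obtain ⟨m, hm, hen, hmin, -⟩ := G.play_succ σ τ hrun hreg hgoal
      have hne : k - n ≠ 0 := fun h0 => by
        rw [h0, G.opt_zero hgoal] at hlt
        exact not_top_lt hlt
      obtain ⟨k', hk'⟩ := Nat.exists_eq_succ_of_ne_zero hne
      have hk'' : k - (n + 1) = k' := by omega
      refine ⟨by omega, ?_⟩
      rw [hm, Run.last_snoc, hk'']
      rw [hk'] at hlt
      cases ho : G.owner (G.play c σ τ n).last.loc
      · rw [G.opt_succ_min hgoal ho] at hlt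
        simp only [iInf_lt_iff] at hlt
        obtain ⟨m', hm', hlt'⟩ := hlt
        have hind : k - (G.play c σ τ n).moves.length - 1 = k' := by omega
        have := hσ (G.play c σ τ n) ⟨m', hm', by rw [hind]; exact hlt'⟩
        rw [hind, ← hmin ho] at this
        exact this
      · rw [G.opt_succ_max hgoal ho] at hlt
        exact lt_of_le_of_lt (le_iSup₂ (f := fun (m : Move L X) (_ : G.Enabled _ m) =>
          G.opt k' m.2.target (((G.play c σ τ n).last.val.delay m.1).reset m.2.resets)) m hen) hlt)
  classical
  have hex : ∃ n, (G.play c σ τ n).last.loc ∈ G.goals := by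
    by_contra hno
    push Not at hno
    have := (hinv (k + 1) fun j _ => hno j).2.2.2.1
    omega
  have hbefore : ∀ j < Nat.find hex, (G.play c σ τ j).last.loc ∉ G.goals := fun j hj =>
    Nat.find_min hex hj
  obtain ⟨hrun, -, -, -, hlt⟩ := hinv (Nat.find hex) hbefore
  rw [G.payoff_eq_out σ τ hrun (Nat.find_spec hex) hbefore]
  rwa [G.opt_goal (Nat.find_spec hex)] at hlt

/-- At a fixed point of value iteration, the maximizing player can keep the function above any
bound below it. -/
lemma exists_strategy_max (hc : c.val ∈ G.reg c.loc) {k : ℕ}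
    (hk : ∀ l, ∀ ν ∈ G.reg l, G.opt (k + 1) l ν = G.opt k l ν) {r : EReal}
    (hr : r < G.opt k c.loc c.val) :
    ∃ τ : G.Strategy Player.max, ∀ σ : G.Strategy Player.min, r < G.payoff c σ τ := by
  obtain ⟨τ, hτ⟩ := G.exists_strategy Player.max fun ρ m =>
    r < G.opt k (ρ.last.next m).loc (ρ.last.next m).val
  refine ⟨τ, fun σ => ?_⟩
  have hinv := G.play_invariant σ τ hc (I := fun _ c => r < G.opt k c.loc c.val) hr (by
      intro n hrun hlen hreg hgoal hlt
      obtain ⟨m, hm, hen, -, hmax⟩ := G.play_succ σ τ hrun hreg hgoal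
      rw [hm, Run.last_snoc]
      rw [← hk _ _ hreg] at hlt
      cases ho : G.owner (G.play c σ τ n).last.loc
      · rw [G.opt_succ_min hgoal ho] at hlt
        exact lt_of_lt_of_le hlt (iInf₂_le (f := fun (m : Move L X) (_ : G.Enabled _ m) =>
          G.opt k m.2.target (((G.play c σ τ n).last.val.delay m.1).reset m.2.resets)) m hen)
      · rw [G.opt_succ_max hgoal ho] at hlt
        simp only [lt_iSup_iff] at hlt
        obtain ⟨m', hm', hlt'⟩ := hlt
        have := hτ (G.play c σ τ n) ⟨m', hm', hlt'⟩
        rw [← hmax ho] at this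
        exact this)
  classical
  by_cases hex : ∃ n, (G.play c σ τ n).last.loc ∈ G.goals
  · have hbefore : ∀ j < Nat.find hex, (G.play c σ τ j).last.loc ∉ G.goals := fun j hj =>
      Nat.find_min hex hj
    obtain ⟨hrun, -, -, hlt⟩ := hinv (Nat.find hex) hbefore
    rw [G.payoff_eq_out σ τ hrun (Nat.find_spec hex) hbefore]
    rwa [G.opt_goal (Nat.find_spec hex)] at hlt
  · rw [payoff, dif_neg hex]
    exact hr.trans_le le_top

lemma lowerValue_le_upperValue (c : Config L X) : G.lowerValue c ≤ G.upperValue c :=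
  iSup_iInf_le_iInf_iSup _

/-- A fixed point of value iteration is both the upper and the lower value. -/
lemma values_eq_opt (hc : c.val ∈ G.reg c.loc) {k : ℕ}
    (hk : ∀ l, ∀ ν ∈ G.reg l, G.opt (k + 1) l ν = G.opt k l ν) :
    G.upperValue c = G.opt k c.loc c.val ∧ G.lowerValue c = G.opt k c.loc c.val := by
  have hup : G.upperValue c ≤ G.opt k c.loc c.val := by
    refine le_of_forall_gt_imp_ge_of_dense fun r hr => ?_
    obtain ⟨σ, hσ⟩ := G.exists_strategy_min hc hr
    exact (iInf_le _ σ).trans (iSup_le fun τ => (hσ τ).le)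
  have hlow : G.opt k c.loc c.val ≤ G.lowerValue c := by
    refine le_of_forall_lt_imp_le_of_dense fun r hr => ?_
    obtain ⟨τ, hτ⟩ := G.exists_strategy_max hc hk hr
    exact (le_iInf fun σ => (hτ σ).le).trans (le_iSup (fun τ => ⨅ σ, G.payoff c σ τ) τ)
  have hmid := G.lowerValue_le_upperValue c
  exact ⟨le_antisymm hup (hlow.trans hmid), le_antisymm (hmid.trans hup) hlow⟩

end KernelWTG

end TimedGame

theorem mainTheorem2 {L X : Type*} [Finite L] [Fintype X] (hX : Fintype.card X = 2)
    (G : TimedGame.KernelWTG L X) :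
    -- the game is determined at every configuration, and every value function is either
    -- identically `+∞` or a real-valued continuous piecewise-linear function
    (∀ i : L, ∀ ν ∈ G.reg i, G.upperValue ⟨i, ν⟩ = G.lowerValue ⟨i, ν⟩) ∧
    (∀ i : L, (∀ ν ∈ G.reg i, G.upperValue ⟨i, ν⟩ = ⊤) ∨
      ∃ W : TimedGame.Valuation X → ℝ, ContinuousOn W (G.reg i) ∧
        TimedGame.PiecewiseLinearOn W (G.reg i) ∧
        ∀ ν ∈ G.reg i, G.upperValue ⟨i, ν⟩ = (W ν : EReal)) ∧
    -- value iteration terminates, with the value functions as its result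
    (∃ k : ℕ, (∀ l : L, ∀ ν ∈ G.reg l, G.opt (k + 1) l ν = G.opt k l ν) ∧
      ∀ l : L, ∀ ν ∈ G.reg l, G.upperValue ⟨l, ν⟩ = G.opt k l ν) ∧
    -- every iterate is finitely represented, over any field that holds the data of the outputs
    (∀ K : Subfield ℝ,
      (∀ l ∈ G.goals, TimedGame.PiecewiseLinearOver K (G.out l) (G.reg l)) →
      ∀ (k : ℕ) (l : L), (∀ ν ∈ G.reg l, G.opt k l ν = ⊤) ∨
        ∃ f : TimedGame.Valuation X → ℝ, ContinuousOn f (G.reg l) ∧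
          TimedGame.PiecewiseLinearOver K f (G.reg l) ∧
          ∀ ν ∈ G.reg l, G.opt k l ν = (f ν : EReal)) := by
  obtain ⟨k, hk⟩ := G.exists_opt_succ_eq hX
  have hval := fun l ν (hν : ν ∈ G.reg l) => G.values_eq_opt (c := ⟨l, ν⟩) hν hk
  have hiter : ∀ K : Subfield ℝ,
      (∀ l ∈ G.goals, TimedGame.PiecewiseLinearOver K (G.out l) (G.reg l)) →
      ∀ (k : ℕ) (l : L), (∀ ν ∈ G.reg l, G.opt k l ν = ⊤) ∨
        ∃ f : TimedGame.Valuation X → ℝ, ContinuousOn f (G.reg l) ∧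
          TimedGame.PiecewiseLinearOver K f (G.reg l) ∧
          ∀ ν ∈ G.reg l, G.opt k l ν = (f ν : EReal) := by
    intro K hK k l
    obtain ⟨Θ, hΘ, hΘK, hsel⟩ := G.exists_forms_of_opt hX hK
    exact (hsel k l).imp id fun ⟨F, hF, h⟩ => ⟨F, hF.1, hF.piecewiseLinearOver hΘ hΘK
      (G.reg_isRegion l).convex (G.reg_isRegion l).nonempty, h⟩
  refine ⟨fun l ν hν => (hval l ν hν).1.trans (hval l ν hν).2.symm, fun l => ?_,
    ⟨k, hk, fun l ν hν => (hval l ν hν).1⟩, hiter⟩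
  refine (hiter ⊤ G.out_piecewiseLinearOn k l).imp (fun h ν hν => ?_) ?_
  · rw [(hval l ν hν).1]
    exact h ν hν
  · rintro ⟨f, hf, hpl, h⟩
    exact ⟨f, hf, hpl, fun ν hν => (hval l ν hν).1.trans (h ν hν)⟩
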